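/- Let $k\ge 2$. An instance of robust fault-tolerant facility location consists of finite sets $\mathcal F$ of facilities and $\mathcal C$ of clients, opening costs $f_i\ge 0$, and metric connection costs $c_{ij}\ge 0$, i.e. $c_{ij}\le c_{ij'}+c_{i'j'}+c_{i'j}$ for all $i,i'\in\mathcal F$ and $j,j'\in\mathcal C$. A scenario is a set $A\subseteq\mathcal F$ with $|A|=k$ (the facilities that fail). A feasible fractional solution is a pair $(x^*,y^*)$ of nonnegative vectors with $$\sum_{i} x^*_{A,ij}\ge 1,\qquad x^*_{A,ij}\le y^*_i,\qquad x^*_{A,ij}=0\ \text{ for } i\in A,$$ for all scenarios $A$, all $i\in\mathcal F$ and all $j\in\mathcal C$. Write $C_{(j,A)}=\sum_i c_{ij}x^*_{A,ij}$ and $F^*=\sum_i f_iy^*_i$; the cost of $(x^*,y^*)$ is $F^*+\max_A\sum_j C_{(j,A)}$ (a maximum over no scenario is $0$). There is a randomized LP-rounding algorithm which, given an instance and any feasible fractional solution $(x^*,y^*)$, outputs a random set $S\subseteq\mathcal F$ of facilities to open, and which has the following properties with $\gamma=k+1.5$. For a scenario $A$ chosen obliviously, i.e. without knowledge of the algorithm's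 random choices, let $d_A(j,S)=\min_{i\in S\setminus A}c_{ij}$ be the cost of connecting client $j$ to the closest surviving open facility ($\infty$ if there is none). Expectations are over the random choices of the algorithm. 1. Each facility $i$ is opened with probability exactly $\min\{1,\gamma y^*_i\}$. 2. For every client $j$ and every scenario $A$, $\mathbb E[d_A(j,S)]\le (k+1.5)\,C_{(j,A)}$. 3. For every scenario $A$, $\mathbb E\big[\sum_{i\in S}f_i+\sum_j d_A(j,S)\big]\le (k+1.5)\,\big(F^*+\sum_j C_{(j,A)}\big)$, and $$\mathbb E\Big[\sum_{i\in S}f_i\Big]+\max_A\mathbb E\Big[\sum_j d_A(j,S)\Big]\le (k+1.5)\Big(F^*+\max_A\sum_j C_{(j,A)}\Big).$$ Here the algorithm is, for each pair of values $|\mathcal F|,|\mathcal C|$, a randomized algebraic computation tree (unit-cost real arithmetic, comparisons, and independent coin tosses with computed real bias), and for each fixed $k$ the number of executed instructions is bounded by a polynomial in the number of real numbers in the input $(f,c,x^*,y^*)$. -/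

import Mathlib

open scoped ENNReal

/-- An instance of metric facility location with facilities `Fin n` and clients `Fin m`.
`dist i j` is the cost of connecting client `j` to facility `i`. The field `dist_triangle` is the
metric condition for connection costs: a nonnegative bipartite cost satisfies it exactly when it
extends to a symmetric (pseudo)metric on facilities and clients together. -/
structure FacilityInstance (n m : ℕ) where
  cost : Fin n → ℝ
  dist : Fin n → Fin m → ℝ
  cost_nonneg : ∀ i, 0 ≤ cost i
  dist_nonneg : ∀ i j, 0 ≤ dist i j
  dist_triangle : ∀ i i' j j', dist i j ≤ dist i j' + dist i' j' + dist i' j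

/-- A scenario: a set of exactly `k` facilities which fail. -/
abbrev Scenario (k n : ℕ) : Type := {A : Finset (Fin n) // A.card = k}

/-- Values of the variables `y i` and `x A i j` of the linear relaxation. -/
structure FractionalSolution (k n m : ℕ) where
  y : Fin n → ℝ
  x : Scenario k n → Fin n → Fin m → ℝ

namespace FractionalSolution

variable {k n m : ℕ}

/-- The constraints of the linear relaxation of robust fault-tolerant facility location. -/
structure IsFeasible (s : FractionalSolution k n m) : Prop where
  covered : ∀ A j, 1 ≤ ∑ i, s.x A i j
  le_opening : ∀ A i j, s.x A i j ≤ s.y i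
  failed : ∀ (A : Scenario k n) (i : Fin n) (j : Fin m), i ∈ A.1 → s.x A i j = 0
  x_nonneg : ∀ A i j, 0 ≤ s.x A i j
  y_nonneg : ∀ i, 0 ≤ s.y i

/-- Fractional facility-opening cost. -/
noncomputable def openingCost (I : FacilityInstance n m) (s : FractionalSolution k n m) : ℝ :=
  ∑ i, I.cost i * s.y i

/-- Fractional connection cost of client `j` in scenario `A`. -/
noncomputable def clientCost (I : FacilityInstance n m) (s : FractionalSolution k n m)
    (A : Scenario k n) (j : Fin m) : ℝ :=
  ∑ i, I.dist i j * s.x A i j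

/-- Objective of the linear relaxation: opening cost plus worst-case connection cost
(there are finitely many scenarios; the maximum is `0` if there is none). -/
noncomputable def objective (I : FacilityInstance n m) (s : FractionalSolution k n m) : ℝ :=
  s.openingCost I + ⨆ A : Scenario k n, ∑ j, s.clientCost I A j

end FractionalSolution

namespace FacilityInstance

variable {n m : ℕ}

/-- Cost of opening the facilities in `S`. -/
noncomputable def openingCost (I : FacilityInstance n m) (S : Finset (Fin n)) : ℝ≥0∞ :=
  ∑ i ∈ S, ENNReal.ofReal (I.cost i)

/-- Distance from client `j` to the closest facility of `S` which is not in the set `A` of failed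
facilities; it is `∞` if no open facility survives. -/
noncomputable def connectionCost (I : FacilityInstance n m) (S A : Finset (Fin n))
    (j : Fin m) : ℝ≥0∞ :=
  ⨅ i ∈ S \ A, ENNReal.ofReal (I.dist i j)

end FacilityInstance

/-! ### Randomized algorithms over the reals -/

/-- Arithmetic operations of the machine. -/
inductive ArithOp : Type
  | plus
  | minus
  | times
  | divide

/-- Result of an arithmetic operation (`a / 0 = 0`). -/
noncomputable def ArithOp.eval : ArithOp → ℝ → ℝ → ℝ
  | .plus, a, b => a + b
  | .minus, a, b => a - b
  | .times, a, b => a * b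
  | .divide, a, b => a / b

/-- A randomized algebraic computation tree, i.e. a loop-free unfolding of a randomized real-RAM
program, with real registers named by `ρ` and outputs in `α`. The program sees the register
contents only through comparisons and through coin tosses whose bias is in a register. -/
inductive RandProgram (ρ α : Type) : Type
  /-- Stop with an output. -/
  | halt (out : α) : RandProgram ρ α
  /-- Store a rational constant in register `dst`. -/
  | load (dst : ρ) (q : ℚ) (next : RandProgram ρ α) : RandProgram ρ α
  /-- Store the result of an operation on registers `a`, `b` in register `dst`. -/
  | arith (op : ArithOp) (dst a b : ρ) (next : RandProgram ρ α) : RandProgram ρ α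
  /-- Go to `yes` if the content of `a` is at most that of `b`, and to `no` otherwise. -/
  | compare (a b : ρ) (yes no : RandProgram ρ α) : RandProgram ρ α
  /-- Toss a fresh independent coin with probability of heads given by register `a`. -/
  | toss (a : ρ) (heads tails : RandProgram ρ α) : RandProgram ρ α

/-- A coin with probability of heads (`true`) equal to `t`, truncated to `[0, 1]`. -/
noncomputable def biasedCoin (t : ℝ) : PMF Bool :=
  PMF.ofFintype
    (fun b => cond b (ENNReal.ofReal (max 0 (min 1 t))) (1 - ENNReal.ofReal (max 0 (min 1 t))))
    (by simp)

namespace RandProgram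

variable {ρ α : Type}

/-- Worst-case number of executed instructions. -/
def steps : RandProgram ρ α → ℕ
  | halt _ => 1
  | load _ _ next => next.steps + 1
  | arith _ _ _ _ next => next.steps + 1
  | compare _ _ yes no => max yes.steps no.steps + 1
  | toss _ heads tails => max heads.steps tails.steps + 1

/-- Distribution of the output when the program is started on the given register contents. -/
noncomputable def run [DecidableEq ρ] : RandProgram ρ α → (ρ → ℝ) → PMF α
  | halt out, _ => PMF.pure out
  | load dst q next, mem => next.run (Function.update mem dst (q : ℝ))
  | arith op dst a b next, mem =>
      next.run (Function.update mem dst (op.eval (mem a) (mem b)))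
  | compare a b yes no, mem =>
      open Classical in if mem a ≤ mem b then yes.run mem else no.run mem
  | toss a heads tails, mem =>
      (biasedCoin (mem a)).bind fun r => if r then heads.run mem else tails.run mem

end RandProgram

/-- Names of the real numbers describing an instance together with a fractional solution:
facility costs, distances, the variables `y i`, and the variables `x A i j`. -/
inductive InputName (k n m : ℕ) : Type
  | cost (i : Fin n) : InputName k n m
  | dist (i : Fin n) (j : Fin m) : InputName k n m
  | y (i : Fin n) : InputName k n m
  | x (A : Scenario k n) (i : Fin n) (j : Fin m) : InputName k n m
  deriving DecidableEq, Fintype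

/-- Registers of a rounding algorithm: input registers and an unlimited supply of others. -/
abbrev Register (k n m : ℕ) : Type := InputName k n m ⊕ ℕ

/-- Initial register contents: the input, and `0` elsewhere. -/
def initialMemory {k n m : ℕ} (I : FacilityInstance n m) (s : FractionalSolution k n m) :
    Register k n m → ℝ
  | .inl (.cost i) => I.cost i
  | .inl (.dist i j) => I.dist i j
  | .inl (.y i) => s.y i
  | .inl (.x A i j) => s.x A i j
  | .inr _ => 0

/-- An LP-rounding algorithm for instances with `n` facilities and `m` clients: it reads the
instance and a fractional solution and outputs the set of facilities to open. -/
abbrev RoundingProgram (k n m : ℕ) : Type := RandProgram (Register k n m) (Finset (Fin n))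

/-- Distribution of the set of facilities opened by a rounding algorithm. The failing facilities
are not an input. -/
noncomputable def RoundingProgram.openSet {k n m : ℕ} (R : RoundingProgram k n m)
    (I : FacilityInstance n m) (s : FractionalSolution k n m) : PMF (Finset (Fin n)) :=
  RandProgram.run R (initialMemory I s)

/-- Expectation of a `[0, ∞]`-valued function of a random set of facilities. -/
noncomputable def expectedCost {n : ℕ} (p : PMF (Finset (Fin n)))
    (g : Finset (Fin n) → ℝ≥0∞) : ℝ≥0∞ :=
  ∑ S, p S * g S

/-! Put γ = k + 3/2. For a client j and a scenario A, let R be the smallest radius at which the ball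
around j has scaled x-mass at least k + 1, and let U be the surviving facilities of that ball. If
some facility of U has γy ≥ 1, it is opened with certainty and survives A. Otherwise U is a
candidate cluster. A greedy choice by increasing R keeps pairwise disjoint candidates, so U meets a
kept cluster of no larger radius, and the triangle inequality puts that whole cluster within 3R of j
(`exists_isClustering`).

Clusters are rounded independently, each by dependent rounding: two fractional openings are replaced
by others with the same sum, one of them integral. This preserves marginals, makes the probability
that a whole set stays closed at most the product of the individual probabilities, and opens at
least the integral part of the cluster's mass. A kept cluster has mass at least k + 1, hence at
least k + 1 open facilities, and k failures cannot destroy them all. So the connection cost d is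
almost surely at most 3R (`exists_open_near`).

Let X(r) be the x-mass within distance r of j. Negative correlation gives P(d > r) ≤ exp(-γX(r)),
while d ≤ 3R gives E d ≤ ∫₀ᴿ (P(d > r) + 2 P(d > R)) dr. Minimality of R yields γX(r) < k + 1 for r
< R, that is γ(1 - X(r)) > 1/2, and `exp_add_two_mul_exp_le` then bounds the integrand by γ(1 -
X(r)). The integral of the latter is at most γ times the fractional connection cost. Here both k ≥ 2
and the extra 1/2 in γ are needed.

For the running time, a fixed polynomial list of comparisons determines a valid clustering. Choosing
it is hard-wired into the branches of the computation tree and costs no instructions, so only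
comparisons and rounding are counted. -/

/-! ### Real expressions and their compilation to the machine. -/

/-- Straight-line real expressions with a comparison-controlled choice. -/
inductive RealExpr (ι : Type) : Type
  | const (q : ℚ) : RealExpr ι
  | var (i : ι) : RealExpr ι
  | arith (op : ArithOp) (a b : RealExpr ι) : RealExpr ι
  /-- The value of `c` if `a ≤ b`, and that of `d` otherwise. -/
  | select (a b c d : RealExpr ι) : RealExpr ι

namespace RealExpr

variable {ι α : Type}

/-- Value of an expression. -/
noncomputable def eval (v : ι → ℝ) : RealExpr ι → ℝ
  | const q => (q : ℝ)
  | var i => v i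
  | arith op a b => op.eval (a.eval v) (b.eval v)
  | select a b c d => open Classical in if a.eval v ≤ b.eval v then c.eval v else d.eval v

/-- Number of instructions which evaluate an expression. -/
def size : RealExpr ι → ℕ
  | const _ => 1
  | var _ => 2
  | arith _ a b => a.size + b.size + 1
  | select a b c d => a.size + b.size + c.size + d.size + 1

/-- Store the value of an expression in the auxiliary register `r`, using only auxiliary registers
from `r` on, and go on with a given program. -/
def compile : RealExpr ι → ℕ → RandProgram (ι ⊕ ℕ) α → RandProgram (ι ⊕ ℕ) α
  | const q, r, p => .load (.inr r) q p
  -- There is no copy instruction, so the input is added to a freshly loaded 0.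
  | var i, r, p => .load (.inr r) 0 (.arith .plus (.inr r) (.inl i) (.inr r) p)
  | arith op a b, r, p =>
      a.compile r (b.compile (r + 1) (.arith op (.inr r) (.inr r) (.inr (r + 1)) p))
  | select a b c d, r, p =>
      a.compile r (b.compile (r + 1)
        (.compare (.inr r) (.inr (r + 1)) (c.compile r p) (d.compile r p)))

theorem steps_compile_le (e : RealExpr ι) (r : ℕ) (p : RandProgram (ι ⊕ ℕ) α) :
    (e.compile r p).steps ≤ e.size + p.steps := by
  induction e generalizing r p with
  | const q => simp only [compile, size, RandProgram.steps]; omega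
  | var i => simp only [compile, size, RandProgram.steps]; omega
  | arith op a b iha ihb =>
    have h := iha r (b.compile (r + 1) (.arith op (.inr r) (.inr r) (.inr (r + 1)) p))
    have h' := ihb (r + 1) (.arith op (.inr r) (.inr r) (.inr (r + 1)) p)
    simp only [compile, size, RandProgram.steps] at *
    omega
  | select a b c d iha ihb ihc ihd =>
    have h := iha r (b.compile (r + 1)
        (.compare (.inr r) (.inr (r + 1)) (c.compile r p) (d.compile r p)))
    have h' := ihb (r + 1) (.compare (.inr r) (.inr (r + 1)) (c.compile r p) (d.compile r p))
    have hc := ihc r p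
    have hd := ihd r p
    simp only [compile, size, RandProgram.steps] at *
    omega

/-- The induction needs three invariants: inputs are never overwritten, registers below `r` survive
(so a left operand outlives the evaluation of the right one), and the final memory does not depend
on the continuation. -/
theorem exists_run_compile [DecidableEq ι] (e : RealExpr ι) (r : ℕ) (mem : ι ⊕ ℕ → ℝ) :
    ∃ mem' : ι ⊕ ℕ → ℝ, mem' ∘ Sum.inl = mem ∘ Sum.inl ∧
      mem' (.inr r) = e.eval (mem ∘ Sum.inl) ∧ (∀ s < r, mem' (.inr s) = mem (.inr s)) ∧
      ∀ p : RandProgram (ι ⊕ ℕ) α, (e.compile r p).run mem = p.run mem' := by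
  induction e generalizing r mem with
  | const q =>
    refine ⟨Function.update mem (.inr r) (q : ℝ), ?_, by simp [eval], fun s hs => ?_,
      fun p => by simp only [compile, RandProgram.run]⟩
    · ext i; simp
    · rw [Function.update_of_ne (by simp [hs.ne])]
  | var i =>
    refine ⟨Function.update (Function.update mem (.inr r) ((0 : ℚ) : ℝ)) (.inr r)
      (mem (.inl i) + 0), ?_, by simp [eval], fun s hs => ?_, fun p => ?_⟩
    · ext i; simp
    · rw [Function.update_of_ne (by simp [hs.ne]), Function.update_of_ne (by simp [hs.ne])]
    · simp [compile, RandProgram.run, ArithOp.eval]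
  | arith op a b iha ihb =>
    obtain ⟨m1, h1, h1r, h1s, h1p⟩ := iha r mem
    obtain ⟨m2, h2, h2r, h2s, h2p⟩ := ihb (r + 1) m1
    refine ⟨Function.update m2 (.inr r) (op.eval (m2 (.inr r)) (m2 (.inr (r + 1)))), ?_, ?_,
      fun s hs => ?_, fun p => ?_⟩
    · rw [← h1, ← h2]; ext i; simp
    · simp [eval, h2r, h2s r (by omega), h1r, h1]
    · rw [Function.update_of_ne (by simp [hs.ne]), h2s s (by omega), h1s s hs]
    · simp only [compile, h1p, h2p, RandProgram.run]
  | select a b c d iha ihb ihc ihd =>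
    obtain ⟨m1, h1, h1r, h1s, h1p⟩ := iha r mem
    obtain ⟨m2, h2, h2r, h2s, h2p⟩ := ihb (r + 1) m1
    have hr : m2 (.inr r) = a.eval (mem ∘ Sum.inl) := by rw [h2s r (by omega), h1r]
    have hr' : m2 (.inr (r + 1)) = b.eval (mem ∘ Sum.inl) := by rw [h2r, h1]
    by_cases hab : a.eval (mem ∘ Sum.inl) ≤ b.eval (mem ∘ Sum.inl)
    · obtain ⟨m3, h3, h3r, h3s, h3p⟩ := ihc r m2
      refine ⟨m3, by rw [h3, h2, h1], ?_, fun s hs => ?_, fun p => ?_⟩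
      · simp only [eval, hab, if_true, h3r, h2, h1]
      · rw [h3s s hs, h2s s (by omega), h1s s hs]
      · simp only [compile, h1p, h2p, RandProgram.run, hr, hr', hab, if_true, h3p]
    · obtain ⟨m3, h3, h3r, h3s, h3p⟩ := ihd r m2
      refine ⟨m3, by rw [h3, h2, h1], ?_, fun s hs => ?_, fun p => ?_⟩
      · simp only [eval, hab, if_false, h3r, h2, h1]
      · rw [h3s s hs, h2s s (by omega), h1s s hs]
      · simp only [compile, h1p, h2p, RandProgram.run, hr, hr', hab, if_false, h3p]

end RealExpr

/-! ### Decision trees: expectation, almost sure properties, compilation. -/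

/-- Randomized decision trees which compare, and toss coins with bias given by, real
expressions in the input. -/
inductive DecisionTree (ι α : Type) : Type
  | halt (out : α) : DecisionTree ι α
  | ask (a b : RealExpr ι) (yes no : DecisionTree ι α) : DecisionTree ι α
  | toss (a : RealExpr ι) (heads tails : DecisionTree ι α) : DecisionTree ι α

/-- Truncation to the unit interval. -/
noncomputable def clampUnit (t : ℝ) : ℝ := max 0 (min 1 t)

theorem clampUnit_nonneg (t : ℝ) : 0 ≤ clampUnit t := le_max_left _ _

theorem clampUnit_le_one (t : ℝ) : clampUnit t ≤ 1 := by simp [clampUnit]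

theorem clampUnit_of_mem {t : ℝ} (h0 : 0 ≤ t) (h1 : t ≤ 1) : clampUnit t = t := by
  simp [clampUnit, h0, h1]

namespace DecisionTree

variable {ι α β : Type}

/-- Expectation of a function of the output. -/
noncomputable def avg (v : ι → ℝ) : DecisionTree ι α → (α → ℝ) → ℝ
  | halt out, g => g out
  | ask a b yes no, g => open Classical in
      if a.eval v ≤ b.eval v then yes.avg v g else no.avg v g
  | toss a heads tails, g =>
      clampUnit (a.eval v) * heads.avg v g + (1 - clampUnit (a.eval v)) * tails.avg v g

/-- The output almost surely has a given property. -/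
def Sure (v : ι → ℝ) : DecisionTree ι α → (α → Prop) → Prop
  | halt out, φ => φ out
  | ask a b yes no, φ =>
      (a.eval v ≤ b.eval v → yes.Sure v φ) ∧ (¬ a.eval v ≤ b.eval v → no.Sure v φ)
  | toss a heads tails, φ =>
      -- Branches of probability zero impose nothing; this is what keeps a facility of opening 1
      -- from ever closing.
      (0 < clampUnit (a.eval v) → heads.Sure v φ) ∧ (clampUnit (a.eval v) < 1 → tails.Sure v φ)

/-- Total size of the expressions evaluated, in the worst case. -/
def cost : DecisionTree ι α → ℕ
  | halt _ => 0
  | ask a b yes no => a.size + b.size + 1 + max yes.cost no.cost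
  | toss a heads tails => a.size + 1 + max heads.cost tails.cost

/-- Sequential composition. -/
def bind : DecisionTree ι α → (α → DecisionTree ι β) → DecisionTree ι β
  | halt out, f => f out
  | ask a b yes no, f => ask a b (yes.bind f) (no.bind f)
  | toss a heads tails, f => toss a (heads.bind f) (tails.bind f)

/-- Apply a function to the output. -/
def map (f : α → β) (t : DecisionTree ι α) : DecisionTree ι β := t.bind fun a => halt (f a)

theorem cost_bind_le (t : DecisionTree ι α) (f : α → DecisionTree ι β) (B : ℕ)
    (h : ∀ a, (f a).cost ≤ B) : (t.bind f).cost ≤ t.cost + B := by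
  induction t with
  | halt out => simpa [bind, cost] using h out
  | ask a b yes no ihy ihn => simp only [bind, cost]; omega
  | toss a heads tails ihh iht => simp only [bind, cost]; omega

theorem cost_map_le (f : α → β) (t : DecisionTree ι α) : (t.map f).cost ≤ t.cost :=
  cost_bind_le t _ 0 fun _ => le_rfl

theorem avg_bind (v : ι → ℝ) (t : DecisionTree ι α) (f : α → DecisionTree ι β) (g : β → ℝ) :
    (t.bind f).avg v g = t.avg v fun a => (f a).avg v g := by
  induction t with
  | halt out => rfl
  | ask a b yes no ihy ihn => simp only [bind, avg, ihy, ihn]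
  | toss a heads tails ihh iht => simp only [bind, avg, ihh, iht]

theorem avg_map (v : ι → ℝ) (f : α → β) (t : DecisionTree ι α) (g : β → ℝ) :
    (t.map f).avg v g = t.avg v fun a => g (f a) :=
  avg_bind v t _ g

theorem avg_mul_const (v : ι → ℝ) (t : DecisionTree ι α) (g : α → ℝ) (c : ℝ) :
    t.avg v (fun a => g a * c) = t.avg v g * c := by
  induction t with
  | halt out => rfl
  | ask a b yes no ihy ihn => simp only [avg, ihy, ihn]; split_ifs <;> rfl
  | toss a heads tails ihh iht => simp only [avg, ihh, iht]; ring

theorem avg_const (v : ι → ℝ) (t : DecisionTree ι α) (c : ℝ) : t.avg v (fun _ => c) = c := by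
  induction t with
  | halt out => rfl
  | ask a b yes no ihy ihn => simp only [avg, ihy, ihn]; split_ifs <;> rfl
  | toss a heads tails ihh iht => simp only [avg, ihh, iht]; ring

theorem avg_mono (v : ι → ℝ) (t : DecisionTree ι α) {g h : α → ℝ} (hgh : ∀ a, g a ≤ h a) :
    t.avg v g ≤ t.avg v h := by
  induction t with
  | halt out => exact hgh out
  | ask a b yes no ihy ihn => simp only [avg]; split_ifs <;> assumption
  | toss a heads tails ihh iht =>
    have := clampUnit_nonneg (a.eval v)
    have := sub_nonneg.2 (clampUnit_le_one (a.eval v))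
    simp only [avg]
    gcongr

theorem avg_nonneg (v : ι → ℝ) (t : DecisionTree ι α) {g : α → ℝ} (hg : ∀ a, 0 ≤ g a) :
    0 ≤ t.avg v g := by
  simpa [avg_const] using avg_mono v t hg

theorem Sure.mono {v : ι → ℝ} {t : DecisionTree ι α} {φ ψ : α → Prop} (h : t.Sure v φ)
    (hφ : ∀ a, φ a → ψ a) : t.Sure v ψ := by
  induction t with
  | halt out => exact hφ _ h
  | ask a b yes no ihy ihn => exact ⟨fun c => ihy (h.1 c), fun c => ihn (h.2 c)⟩
  | toss a heads tails ihh iht => exact ⟨fun c => ihh (h.1 c), fun c => iht (h.2 c)⟩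

theorem Sure.bind {v : ι → ℝ} {t : DecisionTree ι α} {φ : α → Prop}
    {f : α → DecisionTree ι β} {ψ : β → Prop} (h : t.Sure v φ)
    (hf : ∀ a, φ a → (f a).Sure v ψ) : (t.bind f).Sure v ψ := by
  induction t with
  | halt out => exact hf _ h
  | ask a b yes no ihy ihn => exact ⟨fun c => ihy (h.1 c), fun c => ihn (h.2 c)⟩
  | toss a heads tails ihh iht => exact ⟨fun c => ihh (h.1 c), fun c => iht (h.2 c)⟩

theorem sure_true (v : ι → ℝ) (t : DecisionTree ι α) : t.Sure v fun _ => True := by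
  induction t with
  | halt out => trivial
  | ask a b yes no ihy ihn => exact ⟨fun _ => ihy, fun _ => ihn⟩
  | toss a heads tails ihh iht => exact ⟨fun _ => ihh, fun _ => iht⟩

/-- Implementation of a decision tree on the real register machine. -/
def compile : DecisionTree ι α → RandProgram (ι ⊕ ℕ) α
  | halt out => .halt out
  | ask a b yes no =>
      a.compile 0 (b.compile 1 (.compare (.inr 0) (.inr 1) yes.compile no.compile))
  | toss a heads tails => a.compile 0 (.toss (.inr 0) heads.compile tails.compile)

theorem steps_compile_le (t : DecisionTree ι α) : t.compile.steps ≤ t.cost + 1 := by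
  induction t with
  | halt out => simp [compile, RandProgram.steps, cost]
  | ask a b yes no ihy ihn =>
    have h := a.steps_compile_le 0
      (b.compile 1 (.compare (.inr 0) (.inr 1) yes.compile no.compile))
    have h' := b.steps_compile_le 1 (.compare (.inr 0) (.inr 1) yes.compile no.compile)
    simp only [compile, RandProgram.steps, cost] at *
    omega
  | toss a heads tails ihh iht =>
    have h := a.steps_compile_le 0 (.toss (.inr 0) heads.compile tails.compile)
    simp only [compile, RandProgram.steps, cost] at *
    omega

variable [DecidableEq ι]

theorem run_compile_ask (a b : RealExpr ι) (yes no : DecisionTree ι α) (mem : ι ⊕ ℕ → ℝ) :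
    ∃ mem' : ι ⊕ ℕ → ℝ, mem' ∘ Sum.inl = mem ∘ Sum.inl ∧
      (ask a b yes no).compile.run mem = open Classical in
        if a.eval (mem ∘ Sum.inl) ≤ b.eval (mem ∘ Sum.inl) then yes.compile.run mem'
        else no.compile.run mem' := by
  obtain ⟨m1, h1, h1r, -, h1p⟩ := a.exists_run_compile (α := α) 0 mem
  obtain ⟨m2, h2, h2r, h2s, h2p⟩ := b.exists_run_compile (α := α) 1 m1
  refine ⟨m2, by rw [h2, h1], ?_⟩
  simp only [compile, h1p, h2p, RandProgram.run, h2r, h2s 0 one_pos, h1r, h1]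

theorem run_compile_toss (a : RealExpr ι) (heads tails : DecisionTree ι α) (mem : ι ⊕ ℕ → ℝ) :
    ∃ mem' : ι ⊕ ℕ → ℝ, mem' ∘ Sum.inl = mem ∘ Sum.inl ∧
      (toss a heads tails).compile.run mem =
        (biasedCoin (a.eval (mem ∘ Sum.inl))).bind fun r =>
          if r then heads.compile.run mem' else tails.compile.run mem' := by
  obtain ⟨m1, h1, h1r, -, h1p⟩ := a.exists_run_compile (α := α) 0 mem
  exact ⟨m1, h1, by simp only [compile, h1p, RandProgram.run, h1r]⟩

theorem biasedCoin_bind_apply (t : ℝ) (p q : PMF α) (x : α) :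
    ((biasedCoin t).bind fun r => if r then p else q) x =
      ENNReal.ofReal (clampUnit t) * p x + ENNReal.ofReal (1 - clampUnit t) * q x := by
  rw [PMF.bind_apply, tsum_bool, add_comm, ENNReal.ofReal_sub _ (clampUnit_nonneg t)]
  simp [biasedCoin, clampUnit]

/-- Transfers expectations from the machine's output distribution to the real-valued recursion
`avg`, where rounding can be analysed by ordinary algebra. -/
theorem sum_run_compile_mul [Fintype α] (t : DecisionTree ι α) (mem : ι ⊕ ℕ → ℝ) {g : α → ℝ}
    (hg : ∀ a, 0 ≤ g a) :
    ∑ x, t.compile.run mem x * ENNReal.ofReal (g x) =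
      ENNReal.ofReal (t.avg (mem ∘ Sum.inl) g) := by
  classical
  induction t generalizing mem with
  | halt out =>
    simp [compile, RandProgram.run, PMF.pure_apply, avg, ite_mul]
  | ask a b yes no ihy ihn =>
    obtain ⟨m, hm, h⟩ := run_compile_ask a b yes no mem
    rw [h]
    simp only [avg]
    split_ifs
    · rw [ihy, hm]
    · rw [ihn, hm]
  | toss a heads tails ihh iht =>
    obtain ⟨m, hm, h⟩ := run_compile_toss a heads tails mem
    have h0 := clampUnit_nonneg (a.eval (mem ∘ Sum.inl))
    have h1 := sub_nonneg.2 (clampUnit_le_one (a.eval (mem ∘ Sum.inl)))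
    rw [h]
    simp only [biasedCoin_bind_apply, avg, add_mul, Finset.sum_add_distrib, mul_assoc]
    rw [← Finset.mul_sum, ← Finset.mul_sum, ihh, iht, hm,
      ENNReal.ofReal_add (mul_nonneg h0 (avg_nonneg _ _ hg)) (mul_nonneg h1 (avg_nonneg _ _ hg)),
      ENNReal.ofReal_mul h0, ENNReal.ofReal_mul h1]

theorem Sure.of_run_ne_zero {t : DecisionTree ι α} {mem : ι ⊕ ℕ → ℝ} {φ : α → Prop}
    (hs : t.Sure (mem ∘ Sum.inl) φ) {x : α} (hx : t.compile.run mem x ≠ 0) : φ x := by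
  classical
  induction t generalizing mem with
  | halt out =>
    simp only [compile, RandProgram.run, PMF.pure_apply, ne_eq, ite_eq_right_iff,
      one_ne_zero, imp_false, not_not] at hx
    exact hx ▸ hs
  | ask a b yes no ihy ihn =>
    obtain ⟨m, hm, h⟩ := run_compile_ask a b yes no mem
    rw [h] at hx
    rw [← hm] at hs hx
    split_ifs at hx with hab
    · exact ihy (hs.1 hab) hx
    · exact ihn (hs.2 hab) hx
  | toss a heads tails ihh iht =>
    obtain ⟨m, hm, h⟩ := run_compile_toss a heads tails mem
    rw [h, biasedCoin_bind_apply, ← hm] at hx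
    rw [← hm] at hs
    by_cases hh : ENNReal.ofReal (clampUnit (a.eval (m ∘ Sum.inl))) * heads.compile.run m x = 0
    · rw [hh, zero_add] at hx
      have := left_ne_zero_of_mul hx
      simp only [ne_eq, ENNReal.ofReal_eq_zero, not_le, sub_pos] at this
      exact iht (hs.2 this) (right_ne_zero_of_mul hx)
    · have := left_ne_zero_of_mul hh
      simp only [ne_eq, ENNReal.ofReal_eq_zero, not_le] at this
      exact ihh (hs.1 this) (right_ne_zero_of_mul hh)

end DecisionTree

/-! ### Dependent rounding of clusters. -/

namespace DecisionTree

variable {ι σ : Type} [DecidableEq σ]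

/-- Dependent rounding of a list of facilities with fractional openings `w`. The facility `a`, with
remaining fractional opening `e`, is combined with the facilities of the list one after another;
each step makes one of the two openings integral and keeps their sum. -/
def roundCarry (w : σ → RealExpr ι) : σ → RealExpr ι → List σ → DecisionTree ι (Finset σ)
  | a, e, [] => toss e (halt {a}) (halt ∅)
  | a, e, b :: L =>
      ask (.arith .plus e (w b)) (.const 1)
        -- The sum fits into one facility: all of it moves to `a` or to the head `b`, with odds that
        -- keep both expectations.
        (toss (.arith .divide e (.arith .plus e (w b)))
          (roundCarry w a (.arith .plus e (w b)) L)
          (roundCarry w b (.arith .plus e (w b)) L))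
        -- The sum exceeds 1: one facility is opened and the other carries the excess. The bias
        -- solves p + (1 - p)(e + w b - 1) = e.
        (toss (.arith .divide (.arith .minus (.const 1) (w b))
            (.arith .minus (.const 2) (.arith .plus e (w b))))
          ((roundCarry w b (.arith .minus (.arith .plus e (w b)) (.const 1)) L).map (insert a))
          ((roundCarry w a (.arith .minus (.arith .plus e (w b)) (.const 1)) L).map (insert b)))

/-- Dependent rounding of a cluster. -/
def roundCluster (w : σ → RealExpr ι) : List σ → DecisionTree ι (Finset σ)
  | [] => halt ∅
  | a :: L => roundCarry w a (w a) L

/-- Independent rounding of several clusters. -/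
def roundClusters (w : σ → RealExpr ι) : List (List σ) → DecisionTree ι (Finset σ)
  | [] => halt ∅
  | L :: P => (roundCluster w L).bind fun S => (roundClusters w P).map (S ∪ ·)

section Cost

variable {w : σ → RealExpr ι} {K : ℕ}

/-- The carried opening is recomputed from scratch at each step, and its expression grows by at most
K + 3 per merge. `M` bounds the size throughout, whence a quadratic total. -/
theorem cost_roundCarry_le (hw : ∀ i, (w i).size ≤ K) (M : ℕ) (a : σ) (e : RealExpr ι)
    (L : List σ) (hM : e.size + (L.length + 1) * (K + 4) ≤ M) :
    (roundCarry w a e L).cost ≤ (L.length + 1) * (3 * M + 10) := by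
  induction L generalizing a e with
  | nil => simp only [roundCarry, cost, List.length_nil] at *; omega
  | cons b L ih =>
    have hb := hw b
    have h1 : ∀ c, (roundCarry w c (.arith .plus e (w b)) L).cost ≤
        (L.length + 1) * (3 * M + 10) := fun c => ih c _ (by
      simp only [RealExpr.size, List.length_cons, add_mul] at *; omega)
    have h2 : ∀ c, (roundCarry w c (.arith .minus (.arith .plus e (w b)) (.const 1)) L).cost ≤
        (L.length + 1) * (3 * M + 10) := fun c => ih c _ (by
      simp only [RealExpr.size, List.length_cons, add_mul] at *; omega)
    have h3 := fun (c d : σ) => (cost_map_le (insert c) (roundCarry w d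
      (.arith .minus (.arith .plus e (w b)) (.const 1)) L)).trans (h2 d)
    have h4 : e.size + (K + 4) ≤ M := by
      simp only [List.length_cons, add_mul] at hM; omega
    have := h1 a
    have := h1 b
    have := h3 a b
    have := h3 b a
    rw [List.length_cons, add_mul (L.length + 1), one_mul]
    simp only [roundCarry, cost, RealExpr.size]
    omega

theorem cost_roundClusters_le (hw : ∀ i, (w i).size ≤ K) (N : ℕ) (P : List (List σ))
    (hN : P.flatten.length ≤ N) :
    (roundClusters w P).cost ≤
      P.flatten.length * (3 * (K + N * (K + 4)) + 10) := by
  induction P with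
  | nil => simp [roundClusters, cost]
  | cons L P ih =>
    have hlen : (L :: P).flatten.length = L.length + P.flatten.length := by simp
    have hP := ih (by omega)
    have hL : (roundCluster w L).cost ≤ L.length * (3 * (K + N * (K + 4)) + 10) := by
      cases L with
      | nil => simp [roundCluster, cost]
      | cons a L =>
        refine cost_roundCarry_le hw _ a (w a) L (Nat.add_le_add (hw a) ?_)
        exact Nat.mul_le_mul_right _ (by simp only [List.length_cons] at hlen; omega)
    rw [hlen, add_mul]
    refine (cost_bind_le _ _ _ fun S => (cost_map_le _ _).trans hP).trans ?_
    omega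

end Cost

section Rounding

variable {w : σ → RealExpr ι} {v : ι → ℝ}

/-- The value `1 - t` if `a ∈ V`, and `1` otherwise. -/
def missFactor (V : Finset σ) (a : σ) (t : ℝ) : ℝ := if a ∈ V then 1 - t else 1

theorem missFactor_nonneg (V : Finset σ) (a : σ) {t : ℝ} (ht : t ≤ 1) : 0 ≤ missFactor V a t := by
  unfold missFactor; split_ifs <;> linarith

/-- Indicator function of the event that no facility of `V` is open. -/
def missIndicator (V S : Finset σ) : ℝ := if Disjoint S V then 1 else 0

theorem missIndicator_nonneg (V S : Finset σ) : 0 ≤ missIndicator V S := by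
  unfold missIndicator; split_ifs <;> norm_num

/-- The value `0` if `a ∈ V`, and `1` otherwise. -/
def openFactor (V : Finset σ) (a : σ) : ℝ := if a ∈ V then 0 else 1

theorem openFactor_nonneg (V : Finset σ) (a : σ) : 0 ≤ openFactor V a := by
  unfold openFactor; split_ifs <;> norm_num

theorem missIndicator_insert (V S : Finset σ) (a : σ) :
    missIndicator V (insert a S) = missIndicator V S * openFactor V a := by
  unfold missIndicator openFactor
  by_cases h : a ∈ V <;> simp [Finset.disjoint_insert_left, h]

theorem missIndicator_union (V S T : Finset σ) :
    missIndicator V (S ∪ T) = missIndicator V T * missIndicator V S := by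
  unfold missIndicator
  by_cases h : Disjoint S V <;> simp [Finset.disjoint_union_left, h]

/-- The product form survives the degenerate case x + y = 0, where division by zero makes the bias
0. -/
theorem roundingBias_le_one {x y : ℝ} (hx : 0 ≤ x) (hy : 0 ≤ y) :
    clampUnit (x / (x + y)) * (x + y) = x := by
  rw [clampUnit_of_mem (by positivity) (div_le_one_of_le₀ (by linarith) (by positivity))]
  rcases (add_nonneg hx hy).eq_or_lt with h0 | h0
  · rw [← h0]; linarith
  · field_simp

/-- The preceding identity under the symmetry (x, y) ↦ (1 - y, 1 - x), which exchanges open and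
closed. -/
theorem roundingBias_gt_one {x y : ℝ} (hx : x ≤ 1) (hy : y ≤ 1) :
    clampUnit ((1 - y) / (2 - (x + y))) * (2 - (x + y)) = 1 - y := by
  have h := roundingBias_le_one (sub_nonneg.2 hy) (sub_nonneg.2 hx)
  rwa [show (1 - y) + (1 - x) = 2 - (x + y) by ring] at h

/-- If only one of the two facilities lies in `V`, preservation of marginals gives equality; if both
do, the claim is 1 - x - y ≤ (1 - x)(1 - y). -/
theorem missFactor_split_le (V : Finset σ) (a b : σ) {x y : ℝ} (hx : 0 ≤ x) (hy : 0 ≤ y) :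
    clampUnit (x / (x + y)) * missFactor V a (x + y) +
      (1 - clampUnit (x / (x + y))) * missFactor V b (x + y) ≤
        missFactor V a x * missFactor V b y := by
  have h := roundingBias_le_one hx hy
  unfold missFactor
  split_ifs <;> nlinarith [mul_nonneg hx hy]

theorem missFactor_split_eq (V : Finset σ) (a b : σ) {x y : ℝ} (hx : 0 ≤ x) (hy : 0 ≤ y)
    (hab : a ∈ V → b ∉ V) :
    clampUnit (x / (x + y)) * missFactor V a (x + y) +
      (1 - clampUnit (x / (x + y))) * missFactor V b (x + y) =
        missFactor V a x * missFactor V b y := by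
  have h := roundingBias_le_one hx hy
  unfold missFactor
  split_ifs
  · tauto
  all_goals linarith

/-- As before when `V` contains at most one of the two; if it contains both, one of them is now open
and the left side vanishes. -/
theorem missFactor_split_le' (V : Finset σ) (a b : σ) {x y : ℝ} (hx : x ≤ 1) (hy : y ≤ 1) :
    clampUnit ((1 - y) / (2 - (x + y))) * (missFactor V b (x + y - 1) * openFactor V a) +
      (1 - clampUnit ((1 - y) / (2 - (x + y)))) *
        (missFactor V a (x + y - 1) * openFactor V b) ≤
        missFactor V a x * missFactor V b y := by
  have h := roundingBias_gt_one hx hy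
  unfold missFactor openFactor
  split_ifs <;> nlinarith [mul_nonneg (sub_nonneg.2 hx) (sub_nonneg.2 hy)]

theorem missFactor_split_eq' (V : Finset σ) (a b : σ) {x y : ℝ} (hx : x ≤ 1) (hy : y ≤ 1)
    (hab : a ∈ V → b ∉ V) :
    clampUnit ((1 - y) / (2 - (x + y))) * (missFactor V b (x + y - 1) * openFactor V a) +
      (1 - clampUnit ((1 - y) / (2 - (x + y)))) *
        (missFactor V a (x + y - 1) * openFactor V b) =
        missFactor V a x * missFactor V b y := by
  have h := roundingBias_gt_one hx hy
  unfold missFactor openFactor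
  split_ifs
  · tauto
  all_goals linarith

theorem avg_map_insert_missIndicator (t : DecisionTree ι (Finset σ)) (V : Finset σ) (a : σ) :
    (t.map (insert a)).avg v (missIndicator V) =
      t.avg v (missIndicator V) * openFactor V a := by
  simp only [avg_map, missIndicator_insert, avg_mul_const]

theorem prod_missFactor_nonneg (hw1 : ∀ i, (w i).eval v ≤ 1) (V : Finset σ) (L : List σ) :
    0 ≤ (L.map fun i => missFactor V i ((w i).eval v)).prod :=
  List.prod_nonneg (by simpa using fun i _ => missFactor_nonneg V i (hw1 i))

/-- The product of miss factors is a supermartingale along the merges, and the last toss turns the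
remaining factor into a probability. -/
theorem avg_roundCarry_missIndicator_le (hw0 : ∀ i, 0 ≤ (w i).eval v)
    (hw1 : ∀ i, (w i).eval v ≤ 1) (V : Finset σ) (L : List σ) (a : σ) (e : RealExpr ι)
    (he0 : 0 ≤ e.eval v) (he1 : e.eval v ≤ 1) :
    (roundCarry w a e L).avg v (missIndicator V) ≤
      missFactor V a (e.eval v) * (L.map fun i => missFactor V i ((w i).eval v)).prod := by
  induction L generalizing a e with
  | nil =>
    simp only [roundCarry, avg, clampUnit_of_mem he0 he1, missIndicator, missFactor]
    by_cases h : a ∈ V <;> simp [h]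
  | cons b L ih =>
    have hp := prod_missFactor_nonneg hw1 V L
    have hb0 := hw0 b
    have hb1 := hw1 b
    rw [List.map_cons, List.prod_cons, ← mul_assoc]
    simp only [roundCarry, avg, avg_map_insert_missIndicator]
    split_ifs with h
    · simp only [RealExpr.eval, ArithOp.eval] at h ⊢
      push_cast at h
      refine le_trans ?_ (mul_le_mul_of_nonneg_right (missFactor_split_le V a b he0 hb0) hp)
      have := clampUnit_nonneg (e.eval v / (e.eval v + (w b).eval v))
      have := sub_nonneg.2 (clampUnit_le_one (e.eval v / (e.eval v + (w b).eval v)))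
      rw [add_mul, mul_assoc, mul_assoc]
      exact add_le_add
        (mul_le_mul_of_nonneg_left (ih a (.arith .plus e (w b)) (add_nonneg he0 hb0) h) ‹_›)
        (mul_le_mul_of_nonneg_left (ih b (.arith .plus e (w b)) (add_nonneg he0 hb0) h) ‹_›)
    · simp only [RealExpr.eval, ArithOp.eval] at h ⊢
      push_cast at h ⊢
      refine le_trans ?_ (mul_le_mul_of_nonneg_right (missFactor_split_le' V a b he1 hb1) hp)
      set c := clampUnit ((1 - (w b).eval v) / (2 - (e.eval v + (w b).eval v)))
      have h0 : 0 ≤ c := clampUnit_nonneg _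
      have h1 : 0 ≤ 1 - c := sub_nonneg.2 (clampUnit_le_one _)
      have hs : (RealExpr.arith .minus (.arith .plus e (w b)) (.const 1)).eval v =
          e.eval v + (w b).eval v - 1 := by simp [RealExpr.eval, ArithOp.eval]
      have key := fun d => ih d (.arith .minus (.arith .plus e (w b)) (.const 1))
        (by rw [hs]; linarith) (by rw [hs]; linarith)
      simp only [hs] at key
      rw [add_mul, mul_assoc c, mul_assoc (1 - c), mul_right_comm (missFactor V b _),
        mul_right_comm (missFactor V a _)]
      gcongr
      · exact openFactor_nonneg _ _
      · exact key b
      · exact openFactor_nonneg _ _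
      · exact key a

/-- For a single facility the product is a martingale: distinctness means that no merge involves it
on both sides, the only case with strict loss. -/
theorem avg_roundCarry_missIndicator_singleton (hw0 : ∀ i, 0 ≤ (w i).eval v)
    (hw1 : ∀ i, (w i).eval v ≤ 1) (i : σ) (L : List σ) (a : σ) (e : RealExpr ι)
    (he0 : 0 ≤ e.eval v) (he1 : e.eval v ≤ 1) (hnd : (a :: L).Nodup) :
    (roundCarry w a e L).avg v (missIndicator {i}) =
      missFactor {i} a (e.eval v) * (L.map fun l => missFactor {i} l ((w l).eval v)).prod := by
  induction L generalizing a e with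
  | nil =>
    simp only [roundCarry, avg, clampUnit_of_mem he0 he1, missIndicator, missFactor]
    by_cases h : a = i <;> simp [h]
  | cons b L ih =>
    have hb0 := hw0 b
    have hb1 := hw1 b
    have hab : a ∈ ({i} : Finset σ) → b ∉ ({i} : Finset σ) := by
      simp only [List.nodup_cons, List.mem_cons, not_or] at hnd
      simp only [Finset.mem_singleton]
      rintro rfl rfl
      exact hnd.1.1 rfl
    have hbL : (b :: L).Nodup := hnd.of_cons
    have haL : (a :: L).Nodup := by
      simp only [List.nodup_cons, List.mem_cons, not_or] at hnd ⊢
      exact ⟨hnd.1.2, hnd.2.2⟩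
    rw [List.map_cons, List.prod_cons, ← mul_assoc]
    simp only [roundCarry, avg, avg_map_insert_missIndicator]
    split_ifs with h
    · rw [ih a (.arith .plus e (w b)) (add_nonneg he0 hb0) (by simpa [RealExpr.eval] using h) haL,
        ih b (.arith .plus e (w b)) (add_nonneg he0 hb0) (by simpa [RealExpr.eval] using h) hbL,
        ← missFactor_split_eq {i} a b he0 hb0 hab]
      simp only [RealExpr.eval, ArithOp.eval]
      ring
    · have hs : (RealExpr.arith .minus (.arith .plus e (w b)) (.const 1)).eval v =
          e.eval v + (w b).eval v - 1 := by simp [RealExpr.eval, ArithOp.eval]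
      simp only [RealExpr.eval, ArithOp.eval] at h
      push_cast at h
      have key := fun d => ih d (.arith .minus (.arith .plus e (w b)) (.const 1))
        (by rw [hs]; linarith) (by rw [hs]; linarith)
      rw [key b hbL, key a haL, hs, ← missFactor_split_eq' {i} a b he1 hb1 hab]
      simp only [RealExpr.eval, ArithOp.eval]
      push_cast
      ring

/-- Dependent rounding opens almost surely at least the integral part of the mass of a cluster. -/
theorem sure_roundCarry (hw0 : ∀ i, 0 ≤ (w i).eval v)
    (hw1 : ∀ i, (w i).eval v ≤ 1) (L : List σ) (a : σ) (e : RealExpr ι)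
    (he0 : 0 ≤ e.eval v) (he1 : e.eval v ≤ 1) (hnd : (a :: L).Nodup) :
    (roundCarry w a e L).Sure v fun S => (∀ i ∈ S, i ∈ a :: L) ∧
      e.eval v + (L.map fun l => (w l).eval v).sum - 1 < S.card := by
  induction L generalizing a e with
  | nil =>
    refine ⟨fun _ => ⟨by simp, by simp; linarith⟩, fun h => ⟨by simp, ?_⟩⟩
    -- The carry stays closed only if it is below 1, so less than one unit of mass is ever lost.
    rw [clampUnit_of_mem he0 he1] at h
    simpa using h
  | cons b L ih =>
    have hb0 := hw0 b
    have hb1 := hw1 b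
    have hbL : (b :: L).Nodup := hnd.of_cons
    have haL : (a :: L).Nodup := by
      simp only [List.nodup_cons, List.mem_cons, not_or] at hnd ⊢
      exact ⟨hnd.1.2, hnd.2.2⟩
    have hab : a ∉ b :: L := (List.nodup_cons.1 hnd).1
    have hba : b ∉ a :: L := by
      simp only [List.nodup_cons, List.mem_cons, not_or] at hnd ⊢
      exact ⟨fun h => hnd.1.1 h.symm, hnd.2.1⟩
    rw [List.map_cons, List.sum_cons]
    refine ⟨fun h => ?_, fun h => ?_⟩
    · have h' : (RealExpr.arith .plus e (w b)).eval v ≤ 1 := by simpa [RealExpr.eval] using h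
      refine ⟨fun _ => (ih a (.arith .plus e (w b)) (add_nonneg he0 hb0) h' haL).mono fun S hS => ⟨fun i hi => ?_, ?_⟩,
        fun _ => (ih b (.arith .plus e (w b)) (add_nonneg he0 hb0) h' hbL).mono fun S hS => ⟨fun i hi => ?_, ?_⟩⟩
      · have := hS.1 i hi; simp only [List.mem_cons] at this ⊢; tauto
      · have := hS.2; simp only [RealExpr.eval, ArithOp.eval] at this; linarith
      · have := hS.1 i hi; simp only [List.mem_cons] at this ⊢; tauto
      · have := hS.2; simp only [RealExpr.eval, ArithOp.eval] at this; linarith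
    · have hs : (RealExpr.arith .minus (.arith .plus e (w b)) (.const 1)).eval v =
          e.eval v + (w b).eval v - 1 := by simp [RealExpr.eval, ArithOp.eval]
      simp only [RealExpr.eval, ArithOp.eval] at h
      push_cast at h
      have key := fun d => ih d (.arith .minus (.arith .plus e (w b)) (.const 1))
        (by rw [hs]; linarith) (by rw [hs]; linarith)
      rw [hs] at key
      refine ⟨fun _ => (key b hbL).bind fun S hS => ⟨fun i hi => ?_, ?_⟩,
        fun _ => (key a haL).bind fun S hS => ⟨fun i hi => ?_, ?_⟩⟩
      · rcases Finset.mem_insert.1 hi with rfl | hi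
        · simp
        · have := hS.1 i hi; simp only [List.mem_cons] at this ⊢; tauto
      · rw [Finset.card_insert_of_notMem fun ha => hab (hS.1 a ha)]
        have := hS.2
        push_cast
        linarith
      · rcases Finset.mem_insert.1 hi with rfl | hi
        · simp
        · have := hS.1 i hi; simp only [List.mem_cons] at this ⊢; tauto
      · rw [Finset.card_insert_of_notMem fun hb => hba (hS.1 b hb)]
        have := hS.2
        push_cast
        linarith

theorem sure_roundCluster (hw0 : ∀ i, 0 ≤ (w i).eval v) (hw1 : ∀ i, (w i).eval v ≤ 1)
    (L : List σ) (hnd : L.Nodup) :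
    (roundCluster w L).Sure v fun S => (∀ i ∈ S, i ∈ L) ∧
      (L.map fun l => (w l).eval v).sum - 1 < S.card := by
  cases L with
  | nil => exact ⟨by simp, by simp⟩
  | cons a L =>
    rw [List.map_cons, List.sum_cons]
    exact sure_roundCarry hw0 hw1 L a (w a) (hw0 a) (hw1 a) hnd

/-- Every cluster contains almost surely an open subset at least as large as the integral part of
its mass. -/
theorem sure_roundClusters (hw0 : ∀ i, 0 ≤ (w i).eval v) (hw1 : ∀ i, (w i).eval v ≤ 1)
    (P : List (List σ)) (hnd : P.flatten.Nodup) (L : List σ) (hL : L ∈ P) :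
    (roundClusters w P).Sure v fun S => ∃ T ⊆ S, (∀ i ∈ T, i ∈ L) ∧
      (L.map fun l => (w l).eval v).sum - 1 < T.card := by
  induction P with
  | nil => simp at hL
  | cons L' P ih =>
    rw [List.flatten_cons, List.nodup_append] at hnd
    rcases List.mem_cons.1 hL with rfl | hL
    · refine (sure_roundCluster hw0 hw1 L hnd.1).bind fun S hS => ?_
      exact (sure_true v _).bind fun S' _ => ⟨S, Finset.subset_union_left, hS⟩
    · refine (sure_true v _).bind fun S _ => (ih hnd.2.1 hL).bind ?_
      rintro S' ⟨T, hT, h⟩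
      exact ⟨T, hT.trans Finset.subset_union_right, h⟩

/-- Independence: a union misses `V` exactly when both parts do. -/
theorem avg_roundClusters_cons_missIndicator (V : Finset σ) (L : List σ) (P : List (List σ)) :
    (roundClusters w (L :: P)).avg v (missIndicator V) =
      (roundCluster w L).avg v (missIndicator V) *
        (roundClusters w P).avg v (missIndicator V) := by
  simp only [roundClusters, avg_bind, avg_map, missIndicator_union, avg_mul_const]
  simp only [mul_comm ((roundClusters w P).avg v (missIndicator V)), avg_mul_const]

theorem avg_roundClusters_missIndicator_le (hw0 : ∀ i, 0 ≤ (w i).eval v)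
    (hw1 : ∀ i, (w i).eval v ≤ 1) (V : Finset σ) (P : List (List σ)) :
    (roundClusters w P).avg v (missIndicator V) ≤
      (P.flatten.map fun i => missFactor V i ((w i).eval v)).prod := by
  induction P with
  | nil => simp [roundClusters, avg, missIndicator]
  | cons L P ih =>
    rw [avg_roundClusters_cons_missIndicator, List.flatten_cons, List.map_append,
      List.prod_append]
    refine mul_le_mul ?_ ih (avg_nonneg _ _ (missIndicator_nonneg V))
      (prod_missFactor_nonneg hw1 V L)
    cases L with
    | nil => simp [roundCluster, avg, missIndicator]
    | cons a L =>
      exact avg_roundCarry_missIndicator_le hw0 hw1 V L a (w a) (hw0 a) (hw1 a)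

theorem avg_roundClusters_missIndicator_singleton (hw0 : ∀ i, 0 ≤ (w i).eval v)
    (hw1 : ∀ i, (w i).eval v ≤ 1) (i : σ) (P : List (List σ)) (hnd : P.flatten.Nodup) :
    (roundClusters w P).avg v (missIndicator {i}) =
      (P.flatten.map fun l => missFactor {i} l ((w l).eval v)).prod := by
  induction P with
  | nil => simp [roundClusters, avg, missIndicator]
  | cons L P ih =>
    rw [List.flatten_cons, List.nodup_append] at hnd
    rw [avg_roundClusters_cons_missIndicator, List.flatten_cons, List.map_append,
      List.prod_append, ih hnd.2.1]
    congr 1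
    cases L with
    | nil => simp [roundCluster, avg, missIndicator]
    | cons a L =>
      exact avg_roundCarry_missIndicator_singleton hw0 hw1 i L a (w a) (hw0 a) (hw1 a) hnd.1

theorem prod_map_flatten_eq [Fintype σ] {P : List (List σ)} (hnd : P.flatten.Nodup)
    (hmem : ∀ i, i ∈ P.flatten) (f : σ → ℝ) : (P.flatten.map f).prod = ∏ i, f i := by
  rw [← List.prod_toFinset f hnd]
  congr 1
  ext i
  simpa using hmem i

/-- Rounding keeps the marginals. -/
theorem avg_roundClusters_mem [Fintype σ] (hw0 : ∀ i, 0 ≤ (w i).eval v)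
    (hw1 : ∀ i, (w i).eval v ≤ 1) (i : σ) (P : List (List σ)) (hnd : P.flatten.Nodup)
    (hmem : ∀ i, i ∈ P.flatten) :
    (roundClusters w P).avg v (missIndicator {i}) = 1 - (w i).eval v := by
  rw [avg_roundClusters_missIndicator_singleton hw0 hw1 i P hnd, prod_map_flatten_eq hnd hmem]
  simp [missFactor]

/-- Rounding is negatively correlated. -/
theorem avg_roundClusters_missIndicator_le_prod [Fintype σ] (hw0 : ∀ i, 0 ≤ (w i).eval v)
    (hw1 : ∀ i, (w i).eval v ≤ 1) (V : Finset σ) (P : List (List σ)) (hnd : P.flatten.Nodup)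
    (hmem : ∀ i, i ∈ P.flatten) :
    (roundClusters w P).avg v (missIndicator V) ≤ ∏ i ∈ V, (1 - (w i).eval v) := by
  refine (avg_roundClusters_missIndicator_le hw0 hw1 V P).trans_eq ?_
  rw [prod_map_flatten_eq hnd hmem]
  simp [missFactor]

end Rounding

end DecisionTree

/-! ### Asking all comparisons in advance. -/

namespace DecisionTree

variable {ι α κ : Type} [DecidableEq κ]

/-- Answers to a family of comparisons. -/
noncomputable def answers (lhs rhs : κ → RealExpr ι) (v : ι → ℝ) (c : κ) : Bool :=
  open Classical in decide ((lhs c).eval v ≤ (rhs c).eval v)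

/-- Ask a list of comparisons and go on depending on the table of all answers. -/
def askAll (lhs rhs : κ → RealExpr ι) (f : (κ → Bool) → DecisionTree ι α) :
    List κ → (κ → Bool) → DecisionTree ι α
  | [], T => f T
  | c :: l, T => ask (lhs c) (rhs c) (askAll lhs rhs f l (Function.update T c true))
      (askAll lhs rhs f l (Function.update T c false))

variable {lhs rhs : κ → RealExpr ι} {f : (κ → Bool) → DecisionTree ι α}

theorem cost_askAll_le {K B : ℕ} (hl : ∀ c, (lhs c).size + (rhs c).size ≤ K)
    (hf : ∀ T, (f T).cost ≤ B) (l : List κ) (T : κ → Bool) :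
    (askAll lhs rhs f l T).cost ≤ l.length * (K + 1) + B := by
  induction l generalizing T with
  | nil => simpa [askAll] using hf T
  | cons c l ih =>
    have h1 := ih (Function.update T c true)
    have h2 := ih (Function.update T c false)
    have h3 := hl c
    rw [List.length_cons, add_mul]
    simp only [askAll, cost]
    omega

/-- The table is only required to be right off the list; for a complete list its initial value is
immaterial. -/
theorem avg_askAll (v : ι → ℝ) (g : α → ℝ) (l : List κ) (T : κ → Bool)
    (hT : ∀ c ∉ l, T c = answers lhs rhs v c) :
    (askAll lhs rhs f l T).avg v g = (f (answers lhs rhs v)).avg v g := by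
  induction l generalizing T with
  | nil => rw [show T = answers lhs rhs v from funext fun c => hT c (by simp)]; rfl
  | cons c l ih =>
    simp only [askAll, avg]
    split_ifs with h
    all_goals
      refine ih _ fun c' hc' => ?_
      rcases eq_or_ne c' c with rfl | hne
      · simp [answers, h]
      · rw [Function.update_of_ne hne]
        exact hT c' (by simp [hne, hc'])

theorem sure_askAll (v : ι → ℝ) (φ : α → Prop) (l : List κ) (T : κ → Bool)
    (hT : ∀ c ∉ l, T c = answers lhs rhs v c) (hφ : (f (answers lhs rhs v)).Sure v φ) :
    (askAll lhs rhs f l T).Sure v φ := by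
  induction l generalizing T with
  | nil => rwa [show T = answers lhs rhs v from funext fun c => hT c (by simp)]
  | cons c l ih =>
    refine ⟨fun h => ?_, fun h => ?_⟩
    all_goals
      refine ih _ fun c' hc' => ?_
      rcases eq_or_ne c' c with rfl | hne
      · simp [answers, h]
      · rw [Function.update_of_ne hne]
        exact hT c' (by simp [hne, hc'])

end DecisionTree

/-! ### Greedy selection of disjoint sets. -/

/-- Greedy choice of disjoint sets by increasing radius. -/
theorem Finset.exists_disjoint_subfamily {ι σ : Type*} [DecidableEq ι] [DecidableEq σ]
    (Q : Finset ι) (U : ι → Finset σ) (R : ι → ℝ) (hU : ∀ q ∈ Q, (U q).Nonempty) :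
    ∃ M ⊆ Q, (∀ q ∈ M, ∀ q' ∈ M, q ≠ q' → Disjoint (U q) (U q')) ∧
      ∀ q ∈ Q, ∃ q' ∈ M, R q' ≤ R q ∧ ¬ Disjoint (U q) (U q') := by
  induction Q using Finset.strongInduction with
  | H Q ih =>
    rcases Q.eq_empty_or_nonempty with rfl | hne
    · exact ⟨∅, by simp⟩
    obtain ⟨q₀, hq₀, hmin⟩ := Q.exists_min_image R hne
    -- Nonemptiness makes the minimizer meet itself, so removing all sets that meet it shrinks the
    -- family.
    have hself : ∀ q ∈ Q, ¬ Disjoint (U q) (U q) := fun q hq h =>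
      (hU q hq).ne_empty (disjoint_self.1 h)
    obtain ⟨M, hM, hdisj, hcov⟩ := ih (Q.filter fun q => Disjoint (U q) (U q₀))
      (Finset.filter_ssubset.2 ⟨q₀, hq₀, hself q₀ hq₀⟩)
      fun q hq => hU q (Finset.mem_filter.1 hq).1
    refine ⟨insert q₀ M, Finset.insert_subset hq₀ (hM.trans (Finset.filter_subset _ _)), ?_, ?_⟩
    · intro q hq q' hq' hqq'
      rcases Finset.mem_insert.1 hq with rfl | hqM <;>
        rcases Finset.mem_insert.1 hq' with rfl | hqM'
      · exact (hqq' rfl).elim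
      · exact (Finset.mem_filter.1 (hM hqM')).2.symm
      · exact (Finset.mem_filter.1 (hM hqM)).2
      · exact hdisj q hqM q' hqM' hqq'
    · intro q hq
      by_cases h : Disjoint (U q) (U q₀)
      · obtain ⟨q', hq', h'⟩ := hcov q (Finset.mem_filter.2 ⟨hq, h⟩)
        exact ⟨q', Finset.mem_insert_of_mem hq', h'⟩
      · exact ⟨q₀, Finset.mem_insert_self _ _, hmin q hq, h⟩

/-! ### Comparisons made by the algorithm and the clustering they determine. -/

namespace RobustRounding

variable {k n m : ℕ}

/-- Input of a rounding program. -/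
def inputVector (I : FacilityInstance n m) (s : FractionalSolution k n m) :
    InputName k n m → ℝ :=
  initialMemory I s ∘ Sum.inl

/-- The scaled opening `(k + 3/2) y i`. -/
def scaledExpr (k : ℕ) {n m : ℕ} (i : Fin n) : RealExpr (InputName k n m) :=
  .arith .times (.const ((k : ℚ) + 3 / 2)) (.var (.y i))

/-- The opening probability `min 1 ((k + 3/2) y i)`. -/
def openingExpr (k : ℕ) {n m : ℕ} (i : Fin n) : RealExpr (InputName k n m) :=
  .select (.const 1) (scaledExpr k i) (.const 1) (scaledExpr k i)

/-- The sum of `x A i j` over those `i` in a list which are at most as far from `j` as `i₀`. -/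
def ballMassExpr (A : Scenario k n) (i₀ : Fin n) (j : Fin m) :
    List (Fin n) → RealExpr (InputName k n m)
  | [] => .const 0
  | i :: l => .arith .plus
      (.select (.var (.dist i j)) (.var (.dist i₀ j)) (.var (.x A i j)) (.const 0))
      (ballMassExpr A i₀ j l)

/-- Comparisons made by the rounding algorithm. -/
abbrev Test (k n m : ℕ) : Type :=
  (Fin n ⊕ Fin n × Fin n × Fin m) ⊕ (Fin n × Fin n × Fin m ⊕ Scenario k n × Fin n × Fin m)

namespace Test

/-- The test whether `1 ≤ (k + 3/2) y i`. -/
abbrev capped (i : Fin n) : Test k n m := .inl (.inl i)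

/-- The test whether `i` is at most as far from `j` as `i₀`. -/
abbrev near (i i₀ : Fin n) (j : Fin m) : Test k n m := .inl (.inr (i, i₀, j))

/-- The test whether `i` is at most three times as far from `j` as `i₀`. -/
abbrev near3 (i i₀ : Fin n) (j : Fin m) : Test k n m := .inr (.inl (i, i₀, j))

/-- The test whether the facilities at most as far from `j` as `i₀` have scaled mass `k + 1`. -/
abbrev heavy (A : Scenario k n) (i₀ : Fin n) (j : Fin m) : Test k n m := .inr (.inr (A, i₀, j))

/-- Left-hand side of a comparison. -/
def lhs : Test k n m → RealExpr (InputName k n m)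
  | .inl (.inl _) => .const 1
  | .inl (.inr (i, _, j)) => .var (.dist i j)
  | .inr (.inl (i, _, j)) => .var (.dist i j)
  | .inr (.inr _) => .const ((k : ℚ) + 1)

/-- Right-hand side of a comparison. -/
def rhs : Test k n m → RealExpr (InputName k n m)
  | .inl (.inl i) => scaledExpr k i
  | .inl (.inr (_, i₀, j)) => .var (.dist i₀ j)
  | .inr (.inl (_, i₀, j)) => .arith .times (.const 3) (.var (.dist i₀ j))
  | .inr (.inr (A, i₀, j)) =>
      .arith .times (.const ((k : ℚ) + 3 / 2)) (ballMassExpr A i₀ j (List.finRange n))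

end Test

section Semantics

variable (I : FacilityInstance n m) (s : FractionalSolution k n m)

theorem eval_scaledExpr (i : Fin n) :
    (scaledExpr k i).eval (inputVector I s) = ((k : ℝ) + 3 / 2) * s.y i := by
  simp [scaledExpr, RealExpr.eval, ArithOp.eval, inputVector, initialMemory]

theorem eval_openingExpr (i : Fin n) :
    (openingExpr k i).eval (inputVector I s) = min 1 (((k : ℝ) + 3 / 2) * s.y i) := by
  simp only [openingExpr, RealExpr.eval, eval_scaledExpr, Rat.cast_one, min_def]

theorem eval_ballMassExpr (A : Scenario k n) (i₀ : Fin n) (j : Fin m) (l : List (Fin n)) :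
    (ballMassExpr A i₀ j l).eval (inputVector I s) =
      (l.map fun i => if I.dist i j ≤ I.dist i₀ j then s.x A i j else 0).sum := by
  induction l with
  | nil => simp [ballMassExpr, RealExpr.eval]
  | cons i l ih =>
    rw [List.map_cons, List.sum_cons, ← ih]
    simp [ballMassExpr, RealExpr.eval, ArithOp.eval, inputVector, initialMemory]

/-- Mass assigned to the facilities at distance at most `r` from a client. -/
noncomputable def ballMass (A : Scenario k n) (j : Fin m) (r : ℝ) : ℝ :=
  ∑ i with I.dist i j ≤ r, s.x A i j

/-- Answers to the tests. -/
noncomputable abbrev table : Test k n m → Bool :=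
  DecisionTree.answers Test.lhs Test.rhs (inputVector I s)

theorem table_capped (i : Fin n) :
    table I s (Test.capped i) = true ↔ 1 ≤ ((k : ℝ) + 3 / 2) * s.y i := by
  simp [DecisionTree.answers, Test.lhs, Test.rhs, eval_scaledExpr, RealExpr.eval]

theorem table_near (i i₀ : Fin n) (j : Fin m) :
    table I s (Test.near i i₀ j) = true ↔ I.dist i j ≤ I.dist i₀ j := by
  simp [DecisionTree.answers, Test.lhs, Test.rhs, RealExpr.eval, inputVector, initialMemory]

theorem table_near3 (i i₀ : Fin n) (j : Fin m) :
    table I s (Test.near3 i i₀ j) = true ↔ I.dist i j ≤ 3 * I.dist i₀ j := by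
  simp [DecisionTree.answers, Test.lhs, Test.rhs, RealExpr.eval, inputVector, initialMemory,
    ArithOp.eval]

theorem table_heavy (A : Scenario k n) (i₀ : Fin n) (j : Fin m) :
    table I s (Test.heavy A i₀ j) = true ↔
      (k : ℝ) + 1 ≤ ((k : ℝ) + 3 / 2) * ballMass I s A j (I.dist i₀ j) := by
  simp [DecisionTree.answers, Test.lhs, Test.rhs, RealExpr.eval, eval_ballMassExpr,
    ArithOp.eval, ballMass, Finset.sum_filter, ← List.ofFn_eq_map, List.sum_ofFn]

end Semantics

/-- A partition of the facilities into clusters such that, for every client and scenario, some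
cluster which is close to the client keeps an open facility. -/
structure IsClustering (T : Test k n m → Bool) (P : List (List (Fin n))) : Prop where
  nodup : P.flatten.Nodup
  mem_flatten : ∀ i, i ∈ P.flatten
  fallback : ∀ (A : Scenario k n) (j : Fin m), ∃ i₀, T (Test.heavy A i₀ j) = true ∧
    (∀ i₁, T (Test.near i₀ i₁ j) = false → T (Test.heavy A i₁ j) = false) ∧
    ∃ L ∈ P, (∀ i ∈ L, T (Test.near3 i i₀ j) = true) ∧
      ((∃ i ∉ A.1, T (Test.capped i) = true ∧ L = [i]) ∨
        (∀ i ∈ L, T (Test.capped i) = false) ∧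
          ∃ A' i' j', T (Test.heavy A' i' j') = true ∧
            ∀ i ∉ A'.1, T (Test.near i i' j') = true → i ∈ L)

section Existence

variable {I : FacilityInstance n m} {s : FractionalSolution k n m}

theorem ballMass_eq (hs : s.IsFeasible) (A : Scenario k n) (j : Fin m) (r : ℝ) :
    ballMass I s A j r = ∑ i with i ∉ A.1 ∧ I.dist i j ≤ r, s.x A i j := by
  refine (Finset.sum_subset (fun i => ?_) fun i hi hi' => ?_).symm
  · simp only [Finset.mem_filter, Finset.mem_univ, true_and]
    exact And.right
  · simp only [Finset.mem_filter, Finset.mem_univ, true_and, not_and] at hi hi'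
    exact hs.failed A i j (by by_contra h; exact hi' h hi)

/-- Failed facilities carry no x-mass, so a heavy ball is heavy in `y` after the failures; this
makes the surviving part a usable cluster. -/
theorem ballMass_le (hs : s.IsFeasible) (A : Scenario k n) (j : Fin m) (r : ℝ) :
    ballMass I s A j r ≤ ∑ i with i ∉ A.1 ∧ I.dist i j ≤ r, s.y i := by
  rw [ballMass_eq hs]
  exact Finset.sum_le_sum fun i _ => hs.le_opening A i j

/-- The smallest ball around a client of scaled mass `k + 1`. -/
theorem exists_minimal_heavy (hs : s.IsFeasible) (A : Scenario k n) (j : Fin m) :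
    ∃ i₀, table I s (Test.heavy A i₀ j) = true ∧
      ∀ i₁, table I s (Test.near i₀ i₁ j) = false → table I s (Test.heavy A i₁ j) = false := by
  have hne : (Finset.univ : Finset (Fin n)).Nonempty := by
    by_contra h
    have := hs.covered A j
    rw [Finset.not_nonempty_iff_eq_empty.1 h] at this
    norm_num at this
  obtain ⟨a, -, ha⟩ := Finset.univ.exists_max_image (fun i => I.dist i j) hne
  have hheavy : table I s (Test.heavy A a j) = true := by
    -- The ball through the farthest facility contains everything, so its mass is at least 1 and its
    -- scaled mass at least k + 3/2.
    rw [table_heavy, ballMass, Finset.filter_true_of_mem fun i hi => ha i hi]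
    nlinarith [hs.covered A j, (Nat.cast_nonneg k : (0 : ℝ) ≤ k)]
  obtain ⟨i₀, hi₀, hmin⟩ := (Finset.univ.filter fun i => table I s (Test.heavy A i j) = true
    ).exists_min_image (fun i => I.dist i j) ⟨a, by simpa using hheavy⟩
  refine ⟨i₀, by simpa using hi₀, fun i₁ h => ?_⟩
  by_contra h'
  rw [Bool.not_eq_false] at h'
  rw [← Bool.not_eq_true, table_near] at h
  exact h (hmin i₁ (by simpa using h'))

/-- Clusters are the greedily kept survivor sets of minimal heavy balls without capped facilities;
every facility outside them is a singleton. Excluding capped facilities ensures that truncation at 1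
loses none of a cluster's mass. -/
theorem exists_isClustering (hs : s.IsFeasible) : ∃ P, IsClustering (table I s) P := by
  classical
  choose r hr hrmin using fun q : Scenario k n × Fin m =>
    exists_minimal_heavy (I := I) hs q.1 q.2
  set U : Scenario k n × Fin m → Finset (Fin n) := fun q =>
    {i | i ∉ q.1.1 ∧ I.dist i q.2 ≤ I.dist (r q) q.2} with hUdef
  have memU : ∀ q i, i ∈ U q ↔ i ∉ q.1.1 ∧ I.dist i q.2 ≤ I.dist (r q) q.2 := by
    simp [hUdef]
  have hUne : ∀ q, (U q).Nonempty := by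
    intro q
    by_contra h
    have h1 := (table_heavy I s q.1 (r q) q.2).1 (hr q)
    have h2 := ballMass_le (I := I) hs q.1 q.2 (I.dist (r q) q.2)
    rw [show (Finset.univ.filter fun i => i ∉ q.1.1 ∧ I.dist i q.2 ≤ I.dist (r q) q.2) = U q
      from rfl, Finset.not_nonempty_iff_eq_empty.1 h, Finset.sum_empty] at h2
    nlinarith [(Nat.cast_nonneg k : (0 : ℝ) ≤ k)]
  obtain ⟨M, hMQ, hdisj, hcov⟩ := Finset.exists_disjoint_subfamily
    (Finset.univ.filter fun q => ∀ i ∈ U q, table I s (Test.capped i) = false) U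
    (fun q => I.dist (r q) q.2) fun q _ => hUne q
  have hM : ∀ q ∈ M, ∀ i ∈ U q, table I s (Test.capped i) = false := fun q hq =>
    (Finset.mem_filter.1 (hMQ hq)).2
  refine ⟨(M.toList.map fun q => (U q).toList) ++
    (Finset.univ \ M.biUnion U).toList.map fun i => [i], ?_, fun i => ?_, fun A j => ?_⟩
  · rw [List.nodup_flatten]
    refine ⟨fun l hl => ?_, List.pairwise_append.2 ⟨?_, ?_, ?_⟩⟩
    · rw [List.mem_append, List.mem_map, List.mem_map] at hl
      rcases hl with ⟨q, -, rfl⟩ | ⟨i, -, rfl⟩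
      · exact Finset.nodup_toList _
      · simp
    · rw [List.pairwise_map]
      refine M.nodup_toList.imp_of_mem fun {q q'} hq hq' hne i hi hi' => ?_
      exact Finset.disjoint_left.1 (hdisj q (Finset.mem_toList.1 hq) q' (Finset.mem_toList.1 hq')
        hne) (Finset.mem_toList.1 hi) (Finset.mem_toList.1 hi')
    · rw [List.pairwise_map]
      exact (Finset.nodup_toList _).imp fun h => by simpa using h.symm
    · intro l hl l' hl'
      simp only [List.mem_map, Finset.mem_toList, Finset.mem_sdiff, Finset.mem_biUnion,
        Finset.mem_univ, true_and] at hl hl'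
      obtain ⟨q, hq, rfl⟩ := hl
      obtain ⟨i, hi, rfl⟩ := hl'
      intro i' h1 h2
      obtain rfl := List.mem_singleton.1 h2
      exact hi ⟨q, hq, Finset.mem_toList.1 h1⟩
  · by_cases h : ∃ q ∈ M, i ∈ U q
    · obtain ⟨q, hq, hi⟩ := h
      exact List.mem_flatten.2 ⟨(U q).toList, List.mem_append_left _
        (List.mem_map.2 ⟨q, by simpa using hq, rfl⟩), by simpa using hi⟩
    · exact List.mem_flatten.2 ⟨[i], List.mem_append_right _
        (List.mem_map.2 ⟨i, by simpa using h, rfl⟩), by simp⟩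
  · refine ⟨r (A, j), hr (A, j), hrmin (A, j), ?_⟩
    have hR := I.dist_nonneg (r (A, j)) j
    by_cases hc : ∀ i ∈ U (A, j), table I s (Test.capped i) = false
    · obtain ⟨q, hq, hRq, hint⟩ := hcov (A, j) (by simpa using hc)
      obtain ⟨i, hi, hi'⟩ := Finset.not_disjoint_iff.1 hint
      refine ⟨(U q).toList, List.mem_append_left _ (List.mem_map.2 ⟨q, by simpa using hq, rfl⟩),
        fun i' h' => ?_, .inr ⟨fun i' h' => hM q hq i' (by simpa using h'),
          q.1, r q, q.2, hr q, fun i' hA hn => ?_⟩⟩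
      · rw [table_near3]
        -- Path from the cluster member to its own client, then to the common facility `i`, then to
        -- `j`: two radii of the kept cluster plus one of the ball of `j`.
        have h1 := I.dist_triangle i' i j q.2
        have h2 := ((memU _ _).1 hi).2
        have h3 := ((memU _ _).1 hi').2
        have h4 := ((memU _ _).1 (Finset.mem_toList.1 h')).2
        simp only at h2 hRq
        linarith
      · rw [table_near] at hn
        exact Finset.mem_toList.2 ((memU _ _).2 ⟨hA, hn⟩)
    · push Not at hc
      obtain ⟨i, hi, hic⟩ := hc
      rw [ne_eq, Bool.not_eq_false] at hic
      have h2 := (memU _ _).1 hi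
      -- A capped facility lies in no kept cluster, so it forms a singleton.
      refine ⟨[i], List.mem_append_right _ (List.mem_map.2 ⟨i, ?_, rfl⟩), fun i' h' => ?_,
        .inl ⟨i, h2.1, hic, rfl⟩⟩
      · simp only [Finset.mem_toList, Finset.mem_sdiff, Finset.mem_univ, true_and,
          Finset.mem_biUnion, not_exists, not_and]
        intro q hq hiq
        rw [hM q hq i hiq] at hic
        exact Bool.false_ne_true hic
      · obtain rfl := List.mem_singleton.1 h'
        rw [table_near3]
        linarith [h2.2]

end Existence

end RobustRounding

/-! ### The rounding program and its number of steps. -/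

namespace RobustRounding

open DecisionTree MeasureTheory

variable {k n m : ℕ}

/-- A clustering compatible with the given answers to the tests. -/
noncomputable def clustering (T : Test k n m → Bool) : List (List (Fin n)) :=
  -- The default is never reached on feasible input; it only gives the other branches of the tree
  -- some output.
  open Classical in if h : ∃ P, IsClustering T P then h.choose else []

/-- The rounding algorithm: find the clusters, then round each of them. -/
noncomputable def roundingTree (k n m : ℕ) :
    DecisionTree (InputName k n m) (Finset (Fin n)) :=
  askAll Test.lhs Test.rhs (fun T => roundClusters (openingExpr k) (clustering T))
    Finset.univ.toList fun _ => false

/-- The rounding algorithm as a program. -/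
noncomputable def roundingProgram (k n m : ℕ) : RoundingProgram k n m :=
  (roundingTree k n m).compile

section Steps

theorem size_ballMassExpr (A : Scenario k n) (i₀ : Fin n) (j : Fin m) (l : List (Fin n)) :
    (ballMassExpr A i₀ j l).size = 9 * l.length + 1 := by
  induction l with
  | nil => rfl
  | cons i l ih => simp only [ballMassExpr, RealExpr.size, ih, List.length_cons]; ring

theorem size_test_le (c : Test k n m) : c.lhs.size + c.rhs.size ≤ 9 * n + 6 := by
  rcases c with (i | ⟨i, i₀, j⟩) | (⟨i, i₀, j⟩ | ⟨A, i₀, j⟩) <;>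
    simp only [Test.lhs, Test.rhs, RealExpr.size, scaledExpr, size_ballMassExpr,
      List.length_finRange] <;> omega

theorem le_card_inputName : n ≤ Fintype.card (InputName k n m) := by
  simpa using Fintype.card_le_of_injective (fun i : Fin n => (InputName.cost i : InputName k n m))
    fun i j h => by simpa using h

theorem mul_le_card_inputName : n * m ≤ Fintype.card (InputName k n m) := by
  simpa using Fintype.card_le_of_injective
    (fun q : Fin n × Fin m => (InputName.dist q.1 q.2 : InputName k n m))
    fun q q' h => by simpa [Prod.ext_iff] using h

theorem card_scenario_mul_le_card_inputName :
    Fintype.card (Scenario k n) * (n * m) ≤ Fintype.card (InputName k n m) := by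
  have := Fintype.card_le_of_injective
    (fun q : Scenario k n × Fin n × Fin m => (InputName.x q.1 q.2.1 q.2.2 : InputName k n m))
    fun q q' h => by simpa [Prod.ext_iff] using h
  simpa only [Fintype.card_prod, Fintype.card_fin] using this

theorem length_flatten_clustering_le (T : Test k n m → Bool) :
    (clustering T).flatten.length ≤ n := by
  unfold clustering
  split_ifs with h
  · simpa using h.choose_spec.nodup.length_le_card
  · simp

/-- The four kinds of comparison number at most N, N², N² and N, each evaluating expressions of
total size at most 9N + 6. -/
theorem steps_roundingProgram_le (N : ℕ) (hN : Fintype.card (InputName k n m) = N) :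
    (roundingProgram k n m).steps ≤
      (2 * N + 2 * N ^ 2) * (9 * N + 7) + N * (3 * (11 + N * 15) + 10) + 1 := by
  have hn : n ≤ N := hN ▸ le_card_inputName
  have hnm : n * m ≤ N := hN ▸ mul_le_card_inputName
  have hS : Fintype.card (Scenario k n) * (n * m) ≤ N := hN ▸ card_scenario_mul_le_card_inputName
  refine (DecisionTree.steps_compile_le _).trans (Nat.add_le_add_right ?_ 1)
  have hround : ∀ T : Test k n m → Bool,
      (roundClusters (openingExpr (m := m) k) (clustering T)).cost ≤ N * (3 * (11 + N * 15) + 10) := by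
    intro T
    have hlen := (length_flatten_clustering_le T).trans hn
    -- The opening probability is an expression of size 11.
    exact (cost_roundClusters_le (K := 11) (fun i => le_rfl) N _ hlen).trans
      (Nat.mul_le_mul_right _ hlen)
  refine (cost_askAll_le size_test_le hround _ _).trans (Nat.add_le_add_right ?_ _)
  refine Nat.mul_le_mul ?_ (by omega)
  rw [Finset.length_toList, Finset.card_univ]
  simp only [Fintype.card_sum, Fintype.card_prod, Fintype.card_fin]
  have := Nat.mul_le_mul hn hnm
  nlinarith

end Steps

/-! ### Marginals, joint closing probabilities and guaranteed survivors. -/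

section Distribution

variable {I : FacilityInstance n m} {s : FractionalSolution k n m}

theorem eval_openingExpr_nonneg (hs : s.IsFeasible) (i : Fin n) :
    0 ≤ (openingExpr k i).eval (inputVector I s) := by
  rw [eval_openingExpr]
  have := hs.y_nonneg i
  positivity

theorem eval_openingExpr_le_one (i : Fin n) :
    (openingExpr k i).eval (inputVector I s) ≤ 1 := by
  rw [eval_openingExpr]
  exact min_le_left _ _

theorem isClustering_clustering (hs : s.IsFeasible) :
    IsClustering (table I s) (clustering (table I s)) := by
  have h := exists_isClustering (I := I) hs
  rw [clustering, dif_pos h]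
  exact h.choose_spec

theorem sum_openSet_mul {g : Finset (Fin n) → ℝ} (hg : ∀ S, 0 ≤ g S) :
    ∑ S, (roundingProgram k n m).openSet I s S * ENNReal.ofReal (g S) =
      ENNReal.ofReal ((roundClusters (openingExpr k) (clustering (table I s))).avg
        (inputVector I s) g) := by
  rw [RoundingProgram.openSet, roundingProgram, sum_run_compile_mul _ _ hg, roundingTree]
  congr 1
  exact avg_askAll (inputVector I s) g _ _ (by simp)

theorem property_of_openSet_ne_zero {φ : Finset (Fin n) → Prop}
    (hφ : (roundClusters (openingExpr k) (clustering (table I s))).Sure (inputVector I s) φ)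
    {S : Finset (Fin n)} (hS : (roundingProgram k n m).openSet I s S ≠ 0) : φ S := by
  refine Sure.of_run_ne_zero (t := roundingTree k n m) (mem := initialMemory I s) ?_ hS
  exact sure_askAll (inputVector I s) φ _ _ (by simp) hφ

theorem sum_openSet_mul_missIndicator_le (hs : s.IsFeasible) (V : Finset (Fin n)) :
    ∑ S, (roundingProgram k n m).openSet I s S * ENNReal.ofReal (missIndicator V S) ≤
      ENNReal.ofReal (∏ i ∈ V, (1 - min 1 (((k : ℝ) + 3 / 2) * s.y i))) := by
  rw [sum_openSet_mul (missIndicator_nonneg V)]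
  have hP := isClustering_clustering (I := I) hs
  refine ENNReal.ofReal_le_ofReal ((avg_roundClusters_missIndicator_le_prod
    (eval_openingExpr_nonneg hs) eval_openingExpr_le_one V _ hP.nodup hP.mem_flatten).trans_eq ?_)
  simp only [eval_openingExpr]

theorem openSet_toOuterMeasure_mem (hs : s.IsFeasible) (i : Fin n) :
    ((roundingProgram k n m).openSet I s).toOuterMeasure {S | i ∈ S} =
      ENNReal.ofReal (min 1 (((k : ℝ) + 3 / 2) * s.y i)) := by
  set p := (roundingProgram k n m).openSet I s with hp
  have hP := isClustering_clustering (I := I) hs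
  have hmiss : ∑ S, p S * ENNReal.ofReal (missIndicator {i} S) =
      ENNReal.ofReal (1 - min 1 (((k : ℝ) + 3 / 2) * s.y i)) := by
    rw [hp, sum_openSet_mul (missIndicator_nonneg _), avg_roundClusters_mem
      (eval_openingExpr_nonneg hs) eval_openingExpr_le_one i _ hP.nodup hP.mem_flatten,
      eval_openingExpr]
  have hsum : p.toOuterMeasure {S | i ∈ S} +
      ∑ S, p S * ENNReal.ofReal (missIndicator {i} S) = 1 := by
    rw [PMF.toOuterMeasure_apply_fintype, ← Finset.sum_add_distrib, ← p.tsum_coe, tsum_fintype]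
    refine Finset.sum_congr rfl fun S _ => ?_
    by_cases h : i ∈ S <;> simp [missIndicator, h]
  rw [hmiss] at hsum
  rw [ENNReal.eq_sub_of_add_eq ENNReal.ofReal_ne_top hsum, ← ENNReal.ofReal_one,
    ← ENNReal.ofReal_sub _ (sub_nonneg.2 (min_le_left _ _)), sub_sub_cancel]

/-- Almost surely, every client keeps an open facility in every scenario. -/
theorem exists_open_near (hs : s.IsFeasible) {S : Finset (Fin n)}
    (hS : (roundingProgram k n m).openSet I s S ≠ 0) {A : Scenario k n} {j : Fin m}
    {i₀ : Fin n} {L : List (Fin n)} (hL : L ∈ clustering (table I s))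
    (hfall : (∃ i ∉ A.1, table I s (Test.capped i) = true ∧ L = [i]) ∨
        (∀ i ∈ L, table I s (Test.capped i) = false) ∧
          ∃ A' i' j', table I s (Test.heavy A' i' j') = true ∧
            ∀ i ∉ A'.1, table I s (Test.near i i' j') = true → i ∈ L)
    (hnear : ∀ i ∈ L, table I s (Test.near3 i i₀ j) = true) :
    I.connectionCost S A.1 j ≤ ENNReal.ofReal (3 * I.dist i₀ j) := by
  have hP := isClustering_clustering (I := I) hs
  obtain ⟨T, hTS, hTL, hcard⟩ := property_of_openSet_ne_zero (sure_roundClusters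
    (eval_openingExpr_nonneg hs) eval_openingExpr_le_one _ hP.nodup L hL) hS
  simp only [eval_openingExpr] at hcard
  -- The cluster lies within three radii, so a single open survivor in it suffices.
  suffices h : ∃ i ∈ T, i ∉ A.1 by
    obtain ⟨i, hi, hiA⟩ := h
    refine (iInf₂_le i (Finset.mem_sdiff.2 ⟨hTS hi, hiA⟩)).trans (ENNReal.ofReal_le_ofReal ?_)
    exact (table_near3 I s i i₀ j).1 (hnear i (hTL i hi))
  rcases hfall with ⟨i, hiA, hi, rfl⟩ | ⟨hcap, A', i', j', hheavy, hball⟩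
  · rw [table_capped] at hi
    simp only [List.map_cons, List.map_nil, List.sum_cons, List.sum_nil, min_eq_left hi, add_zero,
      sub_self, Nat.cast_pos, Finset.card_pos] at hcard
    obtain ⟨i', hi'⟩ := hcard
    obtain rfl := List.mem_singleton.1 (hTL i' hi')
    exact ⟨i', hi', hiA⟩
  · rw [table_heavy] at hheavy
    have hnd : L.Nodup := (List.nodup_flatten.1 hP.nodup).1 L hL
    have hk : (0 : ℝ) ≤ (k : ℝ) + 3 / 2 := by positivity
    -- Without capped facilities the minimum is inactive.
    have hmass : (L.map fun l => min 1 (((k : ℝ) + 3 / 2) * s.y l)).sum =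
        ((k : ℝ) + 3 / 2) * ∑ l ∈ L.toFinset, s.y l := by
      rw [← List.sum_toFinset _ hnd, Finset.mul_sum]
      refine Finset.sum_congr rfl fun l hl => min_eq_right ?_
      have := hcap l (List.mem_toFinset.1 hl)
      rw [← Bool.not_eq_true, table_capped, not_le] at this
      exact this.le
    have hle : ∑ i with i ∉ A'.1 ∧ I.dist i j' ≤ I.dist i' j', s.y i ≤
        ∑ l ∈ L.toFinset, s.y l := by
      refine Finset.sum_le_sum_of_subset_of_nonneg (fun i hi => ?_) fun i _ _ => hs.y_nonneg i
      simp only [Finset.mem_filter, Finset.mem_univ, true_and] at hi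
      exact List.mem_toFinset.2 (hball i hi.1 ((table_near I s _ _ _).2 hi.2))
    have h1 := mul_le_mul_of_nonneg_left
      ((ballMass_le (I := I) hs A' j' (I.dist i' j')).trans hle) hk
    have hlt : A.1.card < T.card := by
      rw [A.2]
      -- Mass at least k + 1, with less than one unit lost.
      have : (k : ℝ) < T.card := by linarith
      exact_mod_cast this
    obtain ⟨i, hi, hiA⟩ := Finset.exists_mem_notMem_of_card_lt_card hlt
    exact ⟨i, hi, hiA⟩

end Distribution

/-! ### Expected connection and opening costs. -/

section Connection

variable {I : FacilityInstance n m} {s : FractionalSolution k n m}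

/-- A distance of at most `3 R` is at most an integral of indicator functions over `(0, R)`. -/
theorem le_lintegral_indicator {d : ℝ≥0∞} {R : ℝ} (hR : 0 ≤ R) (hd : d ≤ ENNReal.ofReal (3 * R)) :
    d ≤ ∫⁻ r in Set.Ioo 0 R, ((if ENNReal.ofReal r < d then 1 else 0) +
      2 * if ENNReal.ofReal R < d then 1 else 0) := by
  -- Beyond R the integrand is constantly 1 + 2 = 3; otherwise the first indicator alone integrates
  -- to d.
  by_cases h : ENNReal.ofReal R < d
  · refine hd.trans ?_
    rw [setLIntegral_congr_fun (g := fun _ => 3) measurableSet_Ioo]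
    · rw [setLIntegral_const, Real.volume_Ioo, sub_zero, ENNReal.ofReal_mul (by norm_num)]
      simp
    · intro r hr
      have : ENNReal.ofReal r < d := (ENNReal.ofReal_le_ofReal hr.2.le).trans_lt h
      simp only [this, h, if_true]
      norm_num
  · have hd' : d ≠ ⊤ := ne_top_of_le_ne_top ENNReal.ofReal_ne_top hd
    have hdR : d.toReal ≤ R := ENNReal.toReal_le_of_le_ofReal hR (not_lt.1 h)
    calc d = ∫⁻ _ in Set.Ioo 0 d.toReal, 1 := by
          rw [setLIntegral_const, Real.volume_Ioo, sub_zero, one_mul, ENNReal.ofReal_toReal hd']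
      _ ≤ ∫⁻ r in Set.Ioo 0 d.toReal, ((if ENNReal.ofReal r < d then 1 else 0) +
            2 * if ENNReal.ofReal R < d then 1 else 0) := by
          refine setLIntegral_mono' measurableSet_Ioo fun r hr => ?_
          rw [if_pos ((ENNReal.ofReal_lt_iff_lt_toReal hr.1.le hd').2 hr.2)]
          exact le_self_add
      _ ≤ _ := lintegral_mono_set (Set.Ioo_subset_Ioo_right hdR)

theorem lintegral_indicator_lt_le (c R : ℝ) :
    ∫⁻ r in Set.Ioo 0 R, (if r < c then 1 else 0 : ℝ≥0∞) ≤ ENNReal.ofReal c := by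
  calc ∫⁻ r in Set.Ioo 0 R, (if r < c then 1 else 0 : ℝ≥0∞)
      = ∫⁻ r in Set.Ioo 0 R, (Set.Iio c).indicator 1 r := rfl
    _ = volume (Set.Iio c ∩ Set.Ioo 0 R) := by
        rw [lintegral_indicator_one measurableSet_Iio, Measure.restrict_apply measurableSet_Iio]
    _ ≤ volume (Set.Ioo 0 c) := measure_mono fun r hr => ⟨hr.2.1, hr.1⟩
    _ = ENNReal.ofReal c := by rw [Real.volume_Ioo, sub_zero]

/-- Tail bound for the connection cost. -/
theorem sum_openSet_mul_indicator_le (hs : s.IsFeasible) (A : Scenario k n) (j : Fin m) (r : ℝ) :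
    ∑ S, (roundingProgram k n m).openSet I s S *
        (if ENNReal.ofReal r < I.connectionCost S A.1 j then 1 else 0) ≤
      ENNReal.ofReal (Real.exp (-(((k : ℝ) + 3 / 2) * ballMass I s A j r))) := by
  -- Connection cost above r means that every surviving facility within r is closed.
  set V : Finset (Fin n) := {i | i ∉ A.1 ∧ I.dist i j ≤ r} with hV
  calc _ ≤ ∑ S, (roundingProgram k n m).openSet I s S *
        ENNReal.ofReal (missIndicator V S) := by
        refine Finset.sum_le_sum fun S _ => mul_le_mul_right ?_ _
        split_ifs with h
        · rw [missIndicator, if_pos, ENNReal.ofReal_one]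
          refine Finset.disjoint_left.2 fun i hi hiV => ?_
          simp only [hV, Finset.mem_filter, Finset.mem_univ, true_and] at hiV
          refine h.not_ge ((iInf₂_le i (Finset.mem_sdiff.2 ⟨hi, hiV.1⟩)).trans ?_)
          exact ENNReal.ofReal_le_ofReal hiV.2
        · exact zero_le
    _ ≤ _ := sum_openSet_mul_missIndicator_le hs V
    _ ≤ _ := by
        refine ENNReal.ofReal_le_ofReal ?_
        rw [ballMass_eq hs, Finset.mul_sum, ← Finset.sum_neg_distrib, Real.exp_sum]
        refine Finset.prod_le_prod (fun i _ => sub_nonneg.2 (min_le_left _ _)) fun i _ => ?_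
        have hx : ((k : ℝ) + 3 / 2) * s.x A i j ≤ ((k : ℝ) + 3 / 2) * s.y i :=
          mul_le_mul_of_nonneg_left (hs.le_opening A i j) (by positivity)
        rcases le_total 1 (((k : ℝ) + 3 / 2) * s.y i) with h | h
        -- A capped facility is never closed, so its factor is 0; otherwise 1 - t ≤ exp(-t) applies.
        · rw [min_eq_left h, sub_self]
          positivity
        · rw [min_eq_right h]
          linarith [Real.add_one_le_exp (-(((k : ℝ) + 3 / 2) * s.x A i j))]

theorem exp_neg_three_le : Real.exp (-3) ≤ 1 / 13 := by
  -- Four Taylor terms give 1 + 3 + 9/2 + 9/2 = 13.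
  have h := Real.sum_le_exp_of_nonneg (x := 3) (by norm_num) 4
  rw [Real.exp_neg, ← one_div]
  refine one_div_le_one_div_of_le (by norm_num) (le_trans ?_ h)
  norm_num [Finset.sum_range_succ, Nat.factorial]

/-- `X` is the mass of a ball below the critical radius, `Y` that at the radius. The right side is
split as 2(1 - X), which absorbs the first exponential, plus (γ - 2)(1 - X), which absorbs 2/13. -/
theorem exp_add_two_mul_exp_le (hk : 2 ≤ k) {X Y : ℝ} (hX : 0 ≤ X)
    (hXk : ((k : ℝ) + 3 / 2) * X < k + 1) (hY : (k : ℝ) + 1 ≤ ((k : ℝ) + 3 / 2) * Y) :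
    Real.exp (-(((k : ℝ) + 3 / 2) * X)) + 2 * Real.exp (-(((k : ℝ) + 3 / 2) * Y)) ≤
      ((k : ℝ) + 3 / 2) * (1 - X) := by
  have hk' : (2 : ℝ) ≤ k := by exact_mod_cast hk
  have h1 : Real.exp (-(((k : ℝ) + 3 / 2) * Y)) ≤ 1 / 13 :=
    (Real.exp_le_exp.2 (by linarith)).trans exp_neg_three_le
  -- After inversion this is 1 ≤ 2(1 - X)(1 + γX), concave in X, with value 2 at X = 0 and (k +
  -- 2)/(k + 3/2) at γX = k + 1.
  have h2 : Real.exp (-(((k : ℝ) + 3 / 2) * X)) ≤ 2 * (1 - X) := by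
    have ht : 0 ≤ ((k : ℝ) + 3 / 2) * X := by positivity
    rw [Real.exp_neg, inv_le_comm₀ (Real.exp_pos _) (by nlinarith)]
    refine le_trans ?_ (Real.add_one_le_exp _)
    rw [inv_le_iff_one_le_mul₀ (by nlinarith)]
    nlinarith
  have h3 : (1 : ℝ) / 2 ≤ ((k : ℝ) + 3 / 2) * (1 - X) := by nlinarith
  -- Since γ ≥ 7/2 and 1 - X > 1/(2γ), the right side exceeds 3/14.
  have h4 : 2 / 13 ≤ ((k : ℝ) + 3 / 2 - 2) * (1 - X) := by nlinarith
  nlinarith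

theorem ballMass_nonneg (hs : s.IsFeasible) (A : Scenario k n) (j : Fin m) (r : ℝ) :
    0 ≤ ballMass I s A j r :=
  Finset.sum_nonneg fun i _ => hs.x_nonneg A i j

/-- Balls smaller than the smallest heavy ball have small mass. -/
theorem mul_ballMass_lt {A : Scenario k n} {j : Fin m} {i₀ : Fin n}
    (hmin : ∀ i₁, table I s (Test.near i₀ i₁ j) = false → table I s (Test.heavy A i₁ j) = false)
    {r : ℝ} (hr : r < I.dist i₀ j) :
    ((k : ℝ) + 3 / 2) * ballMass I s A j r < k + 1 := by
  rcases (Finset.univ.filter fun i => I.dist i j ≤ r).eq_empty_or_nonempty with h | h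
  · rw [ballMass, h, Finset.sum_empty, mul_zero]
    positivity
  · obtain ⟨i₁, hi₁, hmax⟩ := Finset.exists_max_image _ (fun i => I.dist i j) h
    simp only [Finset.mem_filter, Finset.mem_univ, true_and] at hi₁ hmax
    have h1 := hmin i₁ (by
      rw [← Bool.not_eq_true, table_near, not_le]
      exact hi₁.trans_lt hr)
    rw [← Bool.not_eq_true, table_heavy, not_le] at h1
    have heq : ballMass I s A j r = ballMass I s A j (I.dist i₁ j) := by
      unfold ballMass
      congr 1
      ext i
      simp only [Finset.mem_filter, Finset.mem_univ, true_and]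
      exact ⟨hmax i, fun h => h.trans hi₁⟩
    rwa [heq]

/-- Coverage leaves at least this much mass outside the ball; integrated over r, that outer mass
yields the fractional connection cost. -/
theorem one_sub_ballMass_le (hs : s.IsFeasible) (A : Scenario k n) (j : Fin m) (r : ℝ) :
    1 - ballMass I s A j r ≤ ∑ i, s.x A i j * if r < I.dist i j then 1 else 0 := by
  have h := hs.covered A j
  rw [ballMass, sub_le_iff_le_add, Finset.sum_filter, ← Finset.sum_add_distrib]
  refine h.trans_eq (Finset.sum_congr rfl fun i _ => ?_)
  by_cases hi : I.dist i j ≤ r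
  · simp [hi, hi.not_gt]
  · simp [hi, not_le.1 hi]

theorem expectedCost_connectionCost_le (hk : 2 ≤ k) (hs : s.IsFeasible) (A : Scenario k n)
    (j : Fin m) :
    expectedCost ((roundingProgram k n m).openSet I s) (fun S => I.connectionCost S A.1 j) ≤
      ENNReal.ofReal (((k : ℝ) + 3 / 2) * s.clientCost I A j) := by
  obtain ⟨i₀, hheavy, hmin, L, hL, hnear, hfall⟩ :=
    (isClustering_clustering (I := I) hs).fallback A j
  rw [table_heavy] at hheavy
  set p := (roundingProgram k n m).openSet I s with hp
  set R := I.dist i₀ j with hR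
  have hk0 : (0 : ℝ) ≤ (k : ℝ) + 3 / 2 := by positivity
  set F : Finset (Fin n) → ℝ → ℝ≥0∞ := fun S r =>
    if ENNReal.ofReal r < I.connectionCost S A.1 j then 1 else 0 with hF
  have hFm : ∀ S, Measurable (F S) := fun S =>
    Measurable.ite (measurableSet_lt ENNReal.measurable_ofReal measurable_const)
      measurable_const measurable_const
  have hGm : ∀ i, Measurable fun r : ℝ => (if r < I.dist i j then 1 else 0 : ℝ≥0∞) := fun i =>
    Measurable.ite measurableSet_Iio measurable_const measurable_const
  calc expectedCost p (fun S => I.connectionCost S A.1 j)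
      ≤ ∑ S, p S * ∫⁻ r in Set.Ioo 0 R, (F S r + 2 * F S R) := by
        refine Finset.sum_le_sum fun S _ => ?_
        -- The bound 3R is only almost sure; outcomes of probability zero contribute nothing even
        -- where the cost is infinite.
        rcases eq_or_ne (p S) 0 with h0 | h0
        · simp [h0]
        · exact mul_le_mul_right (le_lintegral_indicator (I.dist_nonneg i₀ j)
            (exists_open_near hs h0 hL hfall hnear)) _
    _ = ∫⁻ r in Set.Ioo 0 R, ∑ S, p S * (F S r + 2 * F S R) := by
        rw [lintegral_finsetSum _ fun S _ => ((hFm S).add_const _).const_mul _]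
        exact Finset.sum_congr rfl fun S _ => (lintegral_const_mul _ ((hFm S).add_const _)).symm
    _ ≤ ∫⁻ r in Set.Ioo 0 R, ENNReal.ofReal ((k : ℝ) + 3 / 2) *
          ∑ i, ENNReal.ofReal (s.x A i j) * (if r < I.dist i j then 1 else 0) := by
        refine setLIntegral_mono' measurableSet_Ioo fun r hr => ?_
        calc ∑ S, p S * (F S r + 2 * F S R)
            = ∑ S, p S * F S r + 2 * ∑ S, p S * F S R := by
              rw [Finset.mul_sum, ← Finset.sum_add_distrib]
              exact Finset.sum_congr rfl fun S _ => by ring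
          _ ≤ ENNReal.ofReal (Real.exp (-(((k : ℝ) + 3 / 2) * ballMass I s A j r))) +
              2 * ENNReal.ofReal (Real.exp (-(((k : ℝ) + 3 / 2) * ballMass I s A j R))) :=
              add_le_add (sum_openSet_mul_indicator_le hs A j r)
                (mul_le_mul_right (sum_openSet_mul_indicator_le hs A j R) _)
          _ = ENNReal.ofReal (Real.exp (-(((k : ℝ) + 3 / 2) * ballMass I s A j r)) +
              2 * Real.exp (-(((k : ℝ) + 3 / 2) * ballMass I s A j R))) := by
              rw [ENNReal.ofReal_add (by positivity) (by positivity),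
                ENNReal.ofReal_mul (by norm_num), ENNReal.ofReal_ofNat]
          _ ≤ ENNReal.ofReal (((k : ℝ) + 3 / 2) *
              ∑ i, s.x A i j * if r < I.dist i j then 1 else 0) := by
              refine ENNReal.ofReal_le_ofReal ((exp_add_two_mul_exp_le hk
                (ballMass_nonneg hs A j r) (mul_ballMass_lt hmin hr.2) hheavy).trans ?_)
              exact mul_le_mul_of_nonneg_left (one_sub_ballMass_le hs A j r) hk0
          _ = _ := by
              rw [ENNReal.ofReal_mul hk0, ENNReal.ofReal_sum_of_nonneg fun i _ =>
                mul_nonneg (hs.x_nonneg A i j) (by split_ifs <;> norm_num)]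
              congr 1
              refine Finset.sum_congr rfl fun i _ => ?_
              rw [ENNReal.ofReal_mul (hs.x_nonneg A i j)]
              split_ifs <;> simp
    _ = ENNReal.ofReal ((k : ℝ) + 3 / 2) * ∑ i, ENNReal.ofReal (s.x A i j) *
          ∫⁻ r in Set.Ioo 0 R, (if r < I.dist i j then 1 else 0) := by
        rw [lintegral_const_mul _ (Finset.measurable_fun_sum _ fun i _ => (hGm i).const_mul _),
          lintegral_finsetSum _ fun i _ => (hGm i).const_mul _]
        congr 1
        exact Finset.sum_congr rfl fun i _ => lintegral_const_mul _ (hGm i)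
    _ ≤ ENNReal.ofReal ((k : ℝ) + 3 / 2) * ∑ i, ENNReal.ofReal (s.x A i j) *
          ENNReal.ofReal (I.dist i j) := by
        refine mul_le_mul_right (Finset.sum_le_sum fun i _ => mul_le_mul_right ?_ _) _
        exact lintegral_indicator_lt_le _ _
    _ = ENNReal.ofReal (((k : ℝ) + 3 / 2) * s.clientCost I A j) := by
        rw [ENNReal.ofReal_mul hk0, FractionalSolution.clientCost,
          ENNReal.ofReal_sum_of_nonneg fun i _ => mul_nonneg (I.dist_nonneg i j)
            (hs.x_nonneg A i j)]
        congr 1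
        refine Finset.sum_congr rfl fun i _ => ?_
        rw [ENNReal.ofReal_mul (I.dist_nonneg i j), mul_comm]

theorem expectedCost_openingCost_le (hs : s.IsFeasible) :
    expectedCost ((roundingProgram k n m).openSet I s) I.openingCost ≤
      ENNReal.ofReal (((k : ℝ) + 3 / 2) * s.openingCost I) := by
  have hk0 : (0 : ℝ) ≤ (k : ℝ) + 3 / 2 := by positivity
  set p := (roundingProgram k n m).openSet I s with hp
  calc expectedCost p I.openingCost
      = ∑ i, ENNReal.ofReal (I.cost i) * p.toOuterMeasure {S | i ∈ S} := by
        simp only [expectedCost, FacilityInstance.openingCost, PMF.toOuterMeasure_apply_fintype,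
          Finset.mul_sum]
        refine (Finset.sum_congr rfl fun S _ => ?_).trans Finset.sum_comm
        simp [Set.indicator_apply, mul_comm]
    _ ≤ ∑ i, ENNReal.ofReal (((k : ℝ) + 3 / 2) * (I.cost i * s.y i)) := by
        refine Finset.sum_le_sum fun i _ => ?_
        rw [openSet_toOuterMeasure_mem hs, ← ENNReal.ofReal_mul (I.cost_nonneg i)]
        refine ENNReal.ofReal_le_ofReal ?_
        rw [mul_left_comm]
        exact mul_le_mul_of_nonneg_left (min_le_right _ _) (I.cost_nonneg i)
    _ = _ := by
        rw [← ENNReal.ofReal_sum_of_nonneg fun i _ => mul_nonneg hk0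
          (mul_nonneg (I.cost_nonneg i) (hs.y_nonneg i)), ← Finset.mul_sum]
        rfl

theorem expectedCost_add (p : PMF (Finset (Fin n))) (g h : Finset (Fin n) → ℝ≥0∞) :
    expectedCost p (fun S => g S + h S) = expectedCost p g + expectedCost p h := by
  simp only [expectedCost, mul_add, Finset.sum_add_distrib]

theorem clientCost_nonneg (hs : s.IsFeasible) (A : Scenario k n) (j : Fin m) :
    0 ≤ s.clientCost I A j :=
  Finset.sum_nonneg fun i _ => mul_nonneg (I.dist_nonneg i j) (hs.x_nonneg A i j)

theorem openingCost_nonneg (hs : s.IsFeasible) : 0 ≤ s.openingCost I :=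
  Finset.sum_nonneg fun i _ => mul_nonneg (I.cost_nonneg i) (hs.y_nonneg i)

theorem expectedCost_sum_connectionCost_le (hk : 2 ≤ k) (hs : s.IsFeasible) (A : Scenario k n) :
    expectedCost ((roundingProgram k n m).openSet I s)
        (fun S => ∑ j, I.connectionCost S A.1 j) ≤
      ENNReal.ofReal (((k : ℝ) + 3 / 2) * ∑ j, s.clientCost I A j) := by
  have hk0 : (0 : ℝ) ≤ (k : ℝ) + 3 / 2 := by positivity
  simp only [expectedCost, Finset.mul_sum]
  rw [Finset.sum_comm, ENNReal.ofReal_sum_of_nonneg fun j _ =>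
    mul_nonneg hk0 (clientCost_nonneg hs A j)]
  exact Finset.sum_le_sum fun j _ => expectedCost_connectionCost_le hk hs A j

end Connection

end RobustRounding

/-! ### Assembly. -/

theorem mainTheorem7 (k : ℕ) (hk : 2 ≤ k) :
    ∃ (alg : ∀ n m : ℕ, RoundingProgram k n m) (P : Polynomial ℕ),
      (∀ n m : ℕ, (alg n m).steps ≤ P.eval (Fintype.card (InputName k n m))) ∧
      ∀ (n m : ℕ) (I : FacilityInstance n m) (s : FractionalSolution k n m), s.IsFeasible →
        (∀ i : Fin n, ((alg n m).openSet I s).toOuterMeasure {S | i ∈ S} =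
          ENNReal.ofReal (min 1 (((k : ℝ) + 1.5) * s.y i))) ∧
        (∀ (A : Scenario k n) (j : Fin m),
          expectedCost ((alg n m).openSet I s) (fun S => I.connectionCost S A.1 j) ≤
            ENNReal.ofReal (((k : ℝ) + 1.5) * s.clientCost I A j)) ∧
        (∀ A : Scenario k n,
          expectedCost ((alg n m).openSet I s)
              (fun S => I.openingCost S + ∑ j, I.connectionCost S A.1 j) ≤
            ENNReal.ofReal
              (((k : ℝ) + 1.5) * (s.openingCost I + ∑ j, s.clientCost I A j))) ∧
        expectedCost ((alg n m).openSet I s) I.openingCost +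
            (⨆ A : Scenario k n, expectedCost ((alg n m).openSet I s)
              (fun S => ∑ j, I.connectionCost S A.1 j)) ≤
          ENNReal.ofReal (((k : ℝ) + 1.5) * s.objective I) := by
  open RobustRounding in
  have hc : (1.5 : ℝ) = 3 / 2 := by norm_num
  have hk0 : (0 : ℝ) ≤ (k : ℝ) + 3 / 2 := by positivity
  rw [hc]
  refine ⟨roundingProgram k, (2 * .X + 2 * .X ^ 2) * (9 * .X + 7) +
    .X * (3 * (11 + .X * 15) + 10) + 1, fun n m => ?_, fun n m I s hs =>
    ⟨openSet_toOuterMeasure_mem hs, expectedCost_connectionCost_le hk hs, fun A => ?_, ?_⟩⟩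
  · refine (steps_roundingProgram_le _ rfl).trans_eq ?_
    simp
  · rw [expectedCost_add, mul_add, ENNReal.ofReal_add
      (mul_nonneg hk0 (openingCost_nonneg hs))
      (mul_nonneg hk0 (Finset.sum_nonneg fun j _ => clientCost_nonneg hs A j))]
    exact add_le_add (expectedCost_openingCost_le hs) (expectedCost_sum_connectionCost_le hk hs A)
  · have hnonneg : ∀ A : Scenario k n, 0 ≤ ∑ j, s.clientCost I A j := fun A =>
      Finset.sum_nonneg fun j _ => clientCost_nonneg hs A j
    -- If n < k there is no scenario, and both suprema, real and extended, take the value 0.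
    rw [FractionalSolution.objective, mul_add, ENNReal.ofReal_add
      (mul_nonneg hk0 (openingCost_nonneg hs)) (mul_nonneg hk0 (Real.iSup_nonneg hnonneg))]
    refine add_le_add (expectedCost_openingCost_le hs) (iSup_le fun A => ?_)
    refine (expectedCost_sum_connectionCost_le hk hs A).trans (ENNReal.ofReal_le_ofReal ?_)
    exact mul_le_mul_of_nonneg_left
      (le_ciSup (Set.finite_range fun A => ∑ j, s.clientCost I A j).bddAbove A) hk0
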